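/- Fix reals $0\le d_-<d_+$. For $n\ge 1$ let $(\mathbf G,\boldsymbol\sigma)$ be the planted bisection model: $\boldsymbol\sigma:[n]\to\{-1,1\}$ is uniformly random among the maps with $\big||\boldsymbol\sigma^{-1}(1)|-|\boldsymbol\sigma^{-1}(-1)|\big|\le 1$, and, given $\boldsymbol\sigma$, any two distinct vertices $v,w\in[n]$ are joined by an edge of $\mathbf G$ independently with probability $2d_+/n$ if $\boldsymbol\sigma(v)=\boldsymbol\sigma(w)$ and $2d_- /n$ otherwise (these numbers are at most $1$ for all large $n$; for the finitely many other $n$ they are replaced by their minimum with $1$, which does not affect the limits below). Let $\mathbf T$ be the two-type Galton–Watson tree with types $\pm1$ whose root $r_{\mathbf T}$ has a uniformly random type and in which every vertex, independently of all others, has ${\rm Po}(d_+)$ children of its own type and, independently, ${\rm Po}(d_-)$ children of the opposite type; let $\boldsymbol\tau$ assign each vertex of $\mathbf T$ its type. For a graph $G$ with root $r$ and a map $\sigma:V(G)\to\{\pm1\}$ let $\partial^t(G,r,\sigma)$ be the rooted labelled graph obtained by deleting all vertices at distance greater than $t$ from $r$ and restricting $\sigma$. Write $\cong$ for isomorphism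 of rooted labelled graphs, that is, a graph isomorphism that maps root to root and preserves the labels. Let $t\ge 0$ be an integer and let $T$ be any tree with root $r$ and a map $\tau:V(T)\to\{\pm1\}$. Then, as $n\to\infty$, $$\frac1n\Big|\big\{v\in[n]:\partial^t(\mathbf G,v,\boldsymbol\sigma)\cong\partial^t(T,r,\tau)\big\}\Big|\ \longrightarrow\ \Pr\big[\partial^t(\mathbf T,r_{\mathbf T},\boldsymbol\tau)\cong\partial^t(T,r,\tau)\big]\quad\text{in probability.}$$ Furthermore, with probability tending to $1$ as $n\to\infty$, there are at most $\ln n$ vertices $v\in[n]$ such that $\partial^t(\mathbf G,v,\boldsymbol\sigma)$ contains a cycle. -/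

import Mathlib

open MeasureTheory ProbabilityTheory Filter Topology
open scoped NNReal ENNReal

/-- A graph on the vertex type `V` with a distinguished root and with labels (types) in
`{1, -1} = ℤˣ` on its vertices. -/
structure RootedLabelledGraph (V : Type*) where
  graph : SimpleGraph V
  root : V
  label : V → ℤˣ

namespace RootedLabelledGraph

/-- The depth-`t` neighbourhood of the root: all vertices at distance greater than `t` from the root
(in particular those in other components, whose extended distance is `⊤`) are deleted, and the
labels are restricted to the remaining induced subgraph. -/
def nbhd {V : Type*} (X : RootedLabelledGraph V) (t : ℕ) :
    RootedLabelledGraph {v : V // X.graph.edist X.root v ≤ (t : ℕ∞)} where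
  graph := X.graph.comap Subtype.val
  root := ⟨X.root, by simp⟩
  label := fun v => X.label v.1

/-- Isomorphism of rooted labelled graphs: a graph isomorphism that maps the root to the root and
preserves the labels. -/
def Isom {V W : Type*} (X : RootedLabelledGraph V) (Y : RootedLabelledGraph W) : Prop :=
  ∃ φ : X.graph ≃g Y.graph, φ X.root = Y.root ∧ ∀ v, X.label v = Y.label (φ v)

end RootedLabelledGraph

namespace PlantedBisection

/-- The maps `σ : [n] → {1, -1}` whose two classes differ in size by at most one. -/
def balanced (n : ℕ) : Finset (Fin n → ℤˣ) :=
  {σ | |(Finset.card {v | σ v = 1} : ℤ) - (Finset.card {v | σ v = -1} : ℤ)| ≤ 1}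

/-- The edge probability `2 d / n` for a graph on `n` vertices. It is cut off at `1`, which only
concerns the finitely many `n < 2 d`. -/
noncomputable def edgeProb (n : ℕ) (d : ℝ≥0) : unitInterval :=
  ⟨min 1 (2 * (d : ℝ) / n), by positivity, min_le_left _ _⟩

/-- The law of the random graph on `[n]` in which any two distinct vertices `v`, `w` are adjacent
with probability `p (σ v * σ w)` independently. The sample space has one independent indicator
for every unordered pair; the indicators of the diagonal pairs are ignored by `fromEdgeSet`. -/
noncomputable def graphLaw (n : ℕ) (p : ℤˣ → unitInterval) (σ : Fin n → ℤˣ) :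
    Measure (SimpleGraph (Fin n)) :=
  (Measure.pi fun e : Sym2 (Fin n) => bernoulliMeasure True False (p (e.map σ).mul)).map
    fun b => SimpleGraph.fromEdgeSet {e | b e}

/-- The joint law of the planted map `σ`, uniform among the balanced maps, and of the planted
bisection graph on `[n]` with edge probabilities `2 dPos / n` inside the classes and `2 dNeg / n`
between them. -/
noncomputable def law (n : ℕ) (dPos dNeg : ℝ≥0) :
    Measure ((Fin n → ℤˣ) × SimpleGraph (Fin n)) :=
  ((balanced n).card : ℝ≥0∞)⁻¹ • ∑ σ ∈ balanced n,
    (graphLaw n (fun s => edgeProb n (if s = 1 then dPos else dNeg)) σ).map (Prod.mk σ)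

/-- A sample of the planted bisection model as a labelled graph rooted at the vertex `v`. -/
def rootedAt {n : ℕ} (ω : (Fin n → ℤˣ) × SimpleGraph (Fin n)) (v : Fin n) :
    RootedLabelledGraph (Fin n) where
  graph := ω.2
  root := v
  label := ω.1

end PlantedBisection

/-! The two-type Galton-Watson tree. Potential individuals are addressed by lists of pairs
`(s, i)`: the root is `[]`, and `(s, i) :: u` is the `i`-th child of `u` among the children whose
type is `s` times the type of `u`. -/

namespace GaltonWatson

/-- Individual `u` has `N u s` children whose type is `s` times the type of `u`. The predicate says
that the individual with the given address is born. -/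
def Born (N : List (ℤˣ × ℕ) → ℤˣ → ℕ) : List (ℤˣ × ℕ) → Prop
  | [] => True
  | x :: u => Born N u ∧ x.2 < N u x.1

/-- The type of an individual when the root has type `θ`. -/
def type (θ : ℤˣ) : List (ℤˣ × ℕ) → ℤˣ
  | [] => θ
  | x :: u => x.1 * type θ u

/-- The family tree with root type `ω.1` and offspring numbers `ω.2`, labelled by the types: its
vertices are the individuals that are born, and its edges join parents and children. -/
def tree (ω : ℤˣ × (List (ℤˣ × ℕ) → ℤˣ → ℕ)) :
    RootedLabelledGraph {u : List (ℤˣ × ℕ) // Born ω.2 u} where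
  graph := SimpleGraph.fromRel fun u w => ∃ x, w.1 = x :: u.1
  root := ⟨[], trivial⟩
  label := fun u => type ω.1 u.1

/-- The law of the root type, which is uniform, and of the offspring numbers, which are all
independent: every individual has `Po(dPos)` children of its own type and `Po(dNeg)` children of
the opposite type. -/
noncomputable def law (dPos dNeg : ℝ≥0) :
    Measure (ℤˣ × (List (ℤˣ × ℕ) → ℤˣ → ℕ)) :=
  (uniformOn Set.univ).prod <| Measure.infinitePi fun _ : List (ℤˣ × ℕ) =>
    Measure.pi fun s : ℤˣ => poissonMeasure (if s = 1 then dPos else dNeg)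

end GaltonWatson

/-! The first claim is a second moment computation. Let `X` be the ball `∂^t(T, r, τ)`, on `m`
vertices. Instead of vertices, count copies: maps of `X` onto a ball of `G` that preserve adjacency
and labels. By `card_copies_eq` their number `N` is `|Aut X|` times the number of vertices whose
ball is isomorphic to `X`.

For a fixed balanced `σ` there are about `(n/2)^m` candidate maps. Such a map is a copy if its `m -
1` tree edges are present, each with probability `2d/n`, and no other edge meets a vertex of depth
less than `t`, which costs about `exp(-(d₊ + d₋))` per such vertex; edges among the image vertices
contribute a factor tending to 1. Hence `E N / n` tends to `c = copyDensity`. Pairs of disjoint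
copies are asymptotically independent; two copies that meet cover a connected set of at most `2m`
vertices, and the expected number of such sets is `O(n)`. So `E N² / n²` is at most `c² + o(1)`, and
Chebyshev's inequality around `c` gives concentration (`tendsto_law_real_isom`). All bounds are
uniform in `σ` and pass to the mixture by `law_real_le`.

On the Galton–Watson side, copies of `X` at the root correspond to orderings of the children in `X`
for which the offspring numbers agree with those of `X` (`card_occurs`). Every ordering has the same
probability, and the number of orderings cancels the factorials in the Poisson weights, so `|Aut X|`
times the probability of the ball is again `c` (`card_isos_mul_law_real`).

For the second claim, a ball with a cycle puts its root into a set `S` of at most `2t + 2` vertices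
spanning at least `|S|` edges. The expected number of such sets is bounded, and Markov's inequality
with threshold `ln n` finishes. -/

namespace SimpleGraph

/-! ### Geodesic parents and small sets spanning many edges -/

variable {V : Type*} {G : SimpleGraph V}

lemma Reachable.exists_adj_dist_add_one {r x : V} (h : G.Reachable r x) (hx : x ≠ r) :
    ∃ p, G.Adj p x ∧ G.Reachable r p ∧ G.dist r p + 1 = G.dist r x := by
  obtain ⟨w, hw⟩ := h.symm.exists_walk_length_eq_dist
  cases w with
  | nil => exact absurd rfl hx
  | @cons _ y _ hxy p =>
    refine ⟨y, hxy.symm, p.reachable.symm, ?_⟩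
    have h1 : G.dist r y ≤ p.length := by rw [dist_comm]; exact dist_le p
    have h2 : G.dist r x ≤ G.dist r y + 1 := by
      obtain ⟨q, hq⟩ := p.reachable.symm.exists_walk_length_eq_dist
      simpa [hq] using dist_le (q.concat hxy.symm)
    rw [Walk.length_cons, dist_comm] at hw
    omega

lemma edist_le_iff_dist_le {r x : V} {t : ℕ} :
    G.edist r x ≤ t ↔ G.Reachable r x ∧ G.dist r x ≤ t := by
  constructor
  · intro h
    have hr : G.Reachable r x :=
      edist_ne_top_iff_reachable.1 (ne_top_of_le_ne_top (ENat.natCast_ne_top t) h)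
    refine ⟨hr, ?_⟩
    rwa [← hr.coe_dist_eq_edist, Nat.cast_le] at h
  · rintro ⟨hr, h⟩
    rwa [← hr.coe_dist_eq_edist, Nat.cast_le]

/-- A choice of a neighbour that is closer to `r`. -/
noncomputable def towards (G : SimpleGraph V) (r x : V) : V :=
  open Classical in
  if h : G.Reachable r x ∧ x ≠ r then (h.1.exists_adj_dist_add_one h.2).choose else x

lemma towards_spec {r x : V} (h : G.Reachable r x) (hx : x ≠ r) :
    G.Adj (G.towards r x) x ∧ G.Reachable r (G.towards r x) ∧
      G.dist r (G.towards r x) + 1 = G.dist r x := by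
  have h' : G.Reachable r x ∧ x ≠ r := ⟨h, hx⟩
  rw [towards, dif_pos h']
  exact (h'.1.exists_adj_dist_add_one h'.2).choose_spec

/-- `S` consists of the vertices of the geodesic obtained by iterating `towards` from `x` until `r`
is reached. -/
lemma exists_finset_towards_closed [DecidableEq V] (r : V) (k : ℕ) (x : V)
    (hx : G.Reachable r x) (hk : G.dist r x ≤ k) :
    ∃ S : Finset V, r ∈ S ∧ x ∈ S ∧ S.card ≤ k + 1 ∧ ∀ z ∈ S, G.Reachable r z ∧
      (z ≠ r → G.towards r z ∈ S) := by
  induction k generalizing x with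
  | zero =>
    have : r = x := (hx.dist_eq_zero_iff).1 (by omega)
    subst this
    exact ⟨{r}, by simp, by simp, by simp, by simp⟩
  | succ k ih =>
    by_cases hxr : x = r
    · subst hxr
      exact ⟨{x}, by simp, by simp, by simp, by simp⟩
    obtain ⟨h1, h2, h3⟩ := towards_spec hx hxr
    obtain ⟨S, hr, hp, hc, hS⟩ := ih _ h2 (by omega)
    refine ⟨insert x S, by simp [hr], by simp, (Finset.card_insert_le _ _).trans (by omega), ?_⟩
    intro z hz
    rcases Finset.mem_insert.1 hz with rfl | hz
    · exact ⟨hx, fun _ => Finset.mem_insert_of_mem hp⟩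
    · exact ⟨(hS z hz).1, fun h => Finset.mem_insert_of_mem ((hS z hz).2 h)⟩

/-- The finite set `S` of vertices spans at least `m` edges of `G`. -/
def SpansEdges (G : SimpleGraph V) (S : Finset V) (m : ℕ) : Prop :=
  ∃ E : Finset (Sym2 V), E ⊆ S.sym2 ∧ E.card = m ∧ ∀ e ∈ E, e ∈ G.edgeSet

/-- The ends of a parent edge differ by one in their distance from `r`, so the edge determines its
farther end. -/
lemma towards_edge_injOn {r : V} {z z' : V} (hz : G.Reachable r z) (hzr : z ≠ r)
    (hz' : G.Reachable r z') (hzr' : z' ≠ r)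
    (h : s(z, G.towards r z) = s(z', G.towards r z')) : z = z' := by
  rcases Sym2.eq_iff.1 h with h | ⟨h1, h2⟩
  · exact h.1
  · have a := (towards_spec hz hzr).2.2
    have b := (towards_spec hz' hzr').2.2
    rw [← h1] at b
    rw [h2] at a
    omega

/-- Two geodesics to `r`, from `x` and from `y`, have at most `t + 1` vertices each. In their union
every vertex but `r` brings its own parent edge, which makes `S.card - 1` edges, and `xy` is one
more. -/
lemma exists_spansEdges_of_edge [DecidableEq V] {r x y : V} {t : ℕ}
    (hx : G.edist r x ≤ t) (hy : G.edist r y ≤ t) (hxy : G.Adj x y)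
    (hxy' : ∀ z, z ≠ r → G.Reachable r z → s(x, y) ≠ s(z, G.towards r z)) :
    ∃ S : Finset V, r ∈ S ∧ S.card ≤ 2 * t + 2 ∧ G.SpansEdges S S.card := by
  rw [edist_le_iff_dist_le] at hx hy
  obtain ⟨A, hrA, hxA, hcA, hA⟩ := G.exists_finset_towards_closed r t x hx.1 hx.2
  obtain ⟨B, hrB, hyB, hcB, hB⟩ := G.exists_finset_towards_closed r t y hy.1 hy.2
  have hAB : ∀ z ∈ A ∪ B, G.Reachable r z ∧ (z ≠ r → G.towards r z ∈ A ∪ B) := by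
    intro z hz
    rcases Finset.mem_union.1 hz with hz | hz
    · exact ⟨(hA z hz).1, fun h => Finset.mem_union_left _ ((hA z hz).2 h)⟩
    · exact ⟨(hB z hz).1, fun h => Finset.mem_union_right _ ((hB z hz).2 h)⟩
  have hr : r ∈ A ∪ B := Finset.mem_union_left _ hrA
  refine ⟨A ∪ B, hr, (Finset.card_union_le _ _).trans (by omega), ?_⟩
  refine ⟨insert s(x, y) (((A ∪ B).erase r).image fun z => s(z, G.towards r z)), ?_, ?_, ?_⟩
  · intro e he
    rcases Finset.mem_insert.1 he with rfl | he
    · simp [hxA, hyB]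
    · obtain ⟨z, hz, rfl⟩ := Finset.mem_image.1 he
      have hz' := Finset.mem_erase.1 hz
      exact Finset.mk_mem_sym2_iff.2 ⟨hz'.2, (hAB z hz'.2).2 hz'.1⟩
  · rw [Finset.card_insert_of_notMem, Finset.card_image_of_injOn, Finset.card_erase_of_mem hr]
    · have := Finset.card_pos.2 ⟨r, hr⟩
      omega
    · intro z hz z' hz' h
      have hz := Finset.mem_erase.1 (Finset.mem_coe.1 hz)
      have hz' := Finset.mem_erase.1 (Finset.mem_coe.1 hz')
      exact towards_edge_injOn (hAB z hz.2).1 hz.1 (hAB z' hz'.2).1 hz'.1 h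
    · intro h
      obtain ⟨z, hz, h⟩ := Finset.mem_image.1 h
      have hz := Finset.mem_erase.1 hz
      exact hxy' z hz.1 (hAB z hz.2).1 h.symm
  · intro e he
    rcases Finset.mem_insert.1 he with rfl | he
    · exact hxy
    · obtain ⟨z, hz, rfl⟩ := Finset.mem_image.1 he
      have hz := Finset.mem_erase.1 hz
      exact (towards_spec (hAB z hz.2).1 hz.1).1.symm

/-- A connected set of vertices spans at least as many edges as a tree does. -/
lemma Connected.spansEdges [DecidableEq V] {S : Finset V} (h : (G.induce (S : Set V)).Connected) :
    G.SpansEdges S (S.card - 1) := by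
  classical
  have h1 := h.card_vert_le_card_edgeSet_add_one
  have h2 : Nat.card (S : Set V) = S.card := by simp
  let f : (G.induce (S : Set V)).edgeSet → Sym2 V := fun e => e.1.map Subtype.val
  have hf : Function.Injective f := fun e e' hee =>
    Subtype.ext (Sym2.map.injective Subtype.val_injective hee)
  have : Finite (S : Set V) := S.finite_toSet
  have : Fintype (G.induce (S : Set V)).edgeSet := Fintype.ofFinite _
  have h3 : S.card - 1 ≤ ((Finset.univ : Finset (G.induce (S : Set V)).edgeSet).image f).card := by
    rw [Finset.card_image_of_injective _ hf, Finset.card_univ, ← Nat.card_eq_fintype_card]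
    omega
  obtain ⟨E, hE, hEc⟩ := Finset.exists_subset_card_eq h3
  have key : ∀ e ∈ E, e ∈ S.sym2 ∧ e ∈ G.edgeSet := by
    intro e he
    obtain ⟨⟨e', he'⟩, -, rfl⟩ := Finset.mem_image.1 (hE he)
    induction e' using Sym2.ind with
    | _ a b => exact ⟨Finset.mk_mem_sym2_iff.2 ⟨a.2, b.2⟩, he'⟩
  exact ⟨E, fun e he => (key e he).1, hEc, fun e he => (key e he).2⟩

end SimpleGraph

/-! ### Balls: connectedness, cycles and parents -/

namespace RootedLabelledGraph

variable {V : Type*} (X : RootedLabelledGraph V) (t : ℕ)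

lemma nbhd_connected : (X.nbhd t).graph.Connected := by
  have key : ∀ d : ℕ, ∀ x : {v // X.graph.edist X.root v ≤ (t : ℕ∞)},
      X.graph.dist X.root x = d → (X.nbhd t).graph.Reachable (X.nbhd t).root x := by
    intro d
    induction d with
    | zero =>
      intro x hx
      have h1 := (SimpleGraph.edist_le_iff_dist_le.1 x.2).1
      have : X.root = x := h1.dist_eq_zero_iff.1 hx
      have : x = (X.nbhd t).root := Subtype.ext this.symm
      rw [this]
    | succ d ih =>
      intro x hx
      have h1 := SimpleGraph.edist_le_iff_dist_le.1 x.2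
      have hne : x.1 ≠ X.root := by
        intro h
        rw [h, SimpleGraph.dist_self] at hx
        omega
      obtain ⟨p, hp, hpr, hpd⟩ := h1.1.exists_adj_dist_add_one hne
      have hpt : X.graph.edist X.root p ≤ t :=
        SimpleGraph.edist_le_iff_dist_le.2 ⟨hpr, by omega⟩
      have hadj : (X.nbhd t).graph.Adj ⟨p, hpt⟩ x := hp
      exact (ih ⟨p, hpt⟩ (by simp only; omega)).trans hadj.reachable
  rw [SimpleGraph.connected_iff_exists_forall_reachable]
  exact ⟨_, fun x => key _ x rfl⟩

/-- If no such `S` exists, every edge of the ball is the parent edge of some vertex other than the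
root. The ball then has fewer edges than vertices, and a connected graph with so few edges is a
tree. -/
lemma exists_spansEdges_of_not_isAcyclic [Finite V] [DecidableEq V]
    (h : ¬ (X.nbhd t).graph.IsAcyclic) :
    ∃ S : Finset V, X.root ∈ S ∧ S.card ≤ 2 * t + 2 ∧ X.graph.SpansEdges S S.card := by
  by_contra hcon
  apply h
  have hall : ∀ x y, X.graph.edist X.root x ≤ t → X.graph.edist X.root y ≤ t → X.graph.Adj x y →
      ∃ z, z ≠ X.root ∧ X.graph.Reachable X.root z ∧ s(x, y) = s(z, X.graph.towards X.root z) := by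
    intro x y hx hy hxy
    by_contra! hne
    exact hcon (SimpleGraph.exists_spansEdges_of_edge hx hy hxy hne)
  have hconn := X.nbhd_connected t
  refine ((SimpleGraph.isTree_iff_connected_and_card).2 ⟨hconn, ?_⟩).isAcyclic
  refine le_antisymm ?_ hconn.card_vert_le_card_edgeSet_add_one
  have hex : ∀ e : (X.nbhd t).graph.edgeSet, ∃ z : {z // z ≠ (X.nbhd t).root},
      e.1.map Subtype.val = s(z.1.1, X.graph.towards X.root z.1.1) := by
    rintro ⟨e, he⟩
    induction e using Sym2.ind with
    | _ a b =>
      obtain ⟨z, hz, -, hzz⟩ := hall a.1 b.1 a.2 b.2 he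
      have hzm : z = a.1 ∨ z = b.1 := by
        have : z ∈ s(a.1, b.1) := by rw [hzz]; simp
        simpa using this
      have hzt : X.graph.edist X.root z ≤ t := by
        rcases hzm with rfl | rfl
        · exact a.2
        · exact b.2
      exact ⟨⟨⟨z, hzt⟩, fun h => hz (congrArg Subtype.val h)⟩, hzz⟩
  choose f hf using hex
  have hinj : Function.Injective f := by
    intro e e' h
    apply Subtype.ext
    apply Sym2.map.injective Subtype.val_injective
    rw [hf, hf, h]
  have h1 := Nat.card_le_card_of_injective f hinj
  have h2 : Nat.card {z // z ≠ (X.nbhd t).root} + 1 =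
      Nat.card {v // X.graph.edist X.root v ≤ (t : ℕ∞)} := by
    classical
    have : Fintype {v // X.graph.edist X.root v ≤ (t : ℕ∞)} := Fintype.ofFinite _
    rw [Nat.card_eq_fintype_card, Nat.card_eq_fintype_card, Fintype.card_subtype_compl,
      Fintype.card_subtype_eq]
    have := Fintype.card_pos_iff.2 ⟨(X.nbhd t).root⟩
    omega
  omega

/-- Parents and depths in a rooted tree of height at most `t`. -/
structure ParentMap {W : Type*} (X : RootedLabelledGraph W) (t : ℕ) where
  parent : W → W
  depth : W → ℕ
  depth_root : depth X.root = 0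
  depth_parent : ∀ w, w ≠ X.root → depth (parent w) + 1 = depth w
  depth_le : ∀ w, depth w ≤ t
  adj_iff : ∀ u w, X.graph.Adj u w ↔
    (w ≠ X.root ∧ parent w = u) ∨ (u ≠ X.root ∧ parent u = w)

/-- Both `u` and the chosen parent are the penultimate vertex of a geodesic from the root to `w`,
and paths in a tree are unique. -/
lemma eq_towards_of_isTree (hX : X.graph.IsTree) {u w : V} (h : X.graph.Adj u w)
    (hd : X.graph.dist X.root u + 1 = X.graph.dist X.root w) : X.graph.towards X.root w = u := by
  have key : ∀ u, X.graph.Adj u w → X.graph.dist X.root u + 1 = X.graph.dist X.root w →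
      ∃ p : X.graph.Walk X.root w, p.IsPath ∧ p.penultimate = u := by
    intro u hu hd
    obtain ⟨q, hq⟩ := hX.connected.exists_walk_length_eq_dist X.root u
    exact ⟨q.concat hu, SimpleGraph.Walk.isPath_of_length_eq_dist _ (by simp [hq, hd]), by simp⟩
  have hne : w ≠ X.root := by
    rintro rfl
    rw [SimpleGraph.dist_self] at hd
    omega
  obtain ⟨h1, -, h3⟩ := SimpleGraph.towards_spec (hX.connected X.root w) hne
  obtain ⟨p, hp, hpu⟩ := key u h hd
  obtain ⟨q, hq, hqu⟩ := key _ h1 h3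
  rw [← hpu, ← hqu, (hX.existsUnique_path X.root w).unique hp hq]

/-- The parent map of a ball around the root of a tree. -/
noncomputable def nbhdParentMap (hX : X.graph.IsTree) : (X.nbhd t).ParentMap t where
  parent := fun w => open Classical in if h : w = (X.nbhd t).root then w else
    ⟨X.graph.towards X.root w, by
      have h2 : w.1 ≠ X.root := fun h' => h (Subtype.ext h')
      obtain ⟨-, h3, h4⟩ := SimpleGraph.towards_spec (hX.connected X.root w) h2
      have := SimpleGraph.edist_le_iff_dist_le.1 w.2
      exact SimpleGraph.edist_le_iff_dist_le.2 ⟨h3, by omega⟩⟩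
  depth := fun w => X.graph.dist X.root w
  depth_root := SimpleGraph.dist_self
  depth_parent := by
    intro w hw
    rw [dif_neg hw]
    exact (SimpleGraph.towards_spec (hX.connected X.root w) (fun h' => hw (Subtype.ext h'))).2.2
  depth_le := fun w => (SimpleGraph.edist_le_iff_dist_le.1 w.2).2
  adj_iff := by
    have key : ∀ (u w : {v // X.graph.edist X.root v ≤ (t : ℕ∞)}) (hw : w ≠ (X.nbhd t).root),
      X.graph.Adj (X.graph.towards X.root w) w := fun u w hw =>
        (SimpleGraph.towards_spec (hX.connected X.root w) (fun h' => hw (Subtype.ext h'))).1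
    intro u w
    constructor
    · intro h
      have h' : X.graph.Adj u.1 w.1 := h
      rcases hX.dist_eq_dist_add_one_of_adj X.root h' with hd | hd
      · right
        have hu : u ≠ (X.nbhd t).root := by
          rintro rfl
          have : X.graph.dist X.root X.root = X.graph.dist X.root w.1 + 1 := hd
          simp at this
        refine ⟨hu, ?_⟩
        rw [dif_neg hu]
        exact Subtype.ext (X.eq_towards_of_isTree hX h'.symm hd.symm)
      · left
        have hw : w ≠ (X.nbhd t).root := by
          rintro rfl
          have : X.graph.dist X.root X.root = X.graph.dist X.root u.1 + 1 := hd
          simp at this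
        refine ⟨hw, ?_⟩
        rw [dif_neg hw]
        exact Subtype.ext (X.eq_towards_of_isTree hX h' hd.symm)
    · rintro (⟨hw, h⟩ | ⟨hu, h⟩)
      · rw [dif_neg hw] at h
        subst h
        exact key w w hw
      · rw [dif_neg hu] at h
        subst h
        exact (key u u hu).symm

end RootedLabelledGraph

/-! ### Copies of a ball and isomorphisms -/

namespace RootedLabelledGraph

variable {V W : Type*}

/-- The isomorphisms of rooted labelled graphs. -/
abbrev Isos (X : RootedLabelledGraph V) (Y : RootedLabelledGraph W) : Type _ :=
  {ψ : X.graph ≃g Y.graph // ψ X.root = Y.root ∧ ∀ v, X.label v = Y.label (ψ v)}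

lemma isom_iff_nonempty {X : RootedLabelledGraph V} {Y : RootedLabelledGraph W} :
    X.Isom Y ↔ Nonempty (Isos X Y) :=
  ⟨fun ⟨ψ, h⟩ => ⟨⟨ψ, h⟩⟩, fun ⟨⟨ψ, h⟩⟩ => ⟨ψ, h⟩⟩

def Isos.symm {X : RootedLabelledGraph V} {Y : RootedLabelledGraph W} (ψ : Isos X Y) : Isos Y X :=
  ⟨ψ.1.symm, (congrArg ψ.1.symm ψ.2.1.symm).trans (RelIso.symm_apply_apply _ _), fun v => by
    rw [ψ.2.2, RelIso.apply_symm_apply]⟩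

def Isos.trans {U : Type*} {X : RootedLabelledGraph V} {Y : RootedLabelledGraph W}
    {Z : RootedLabelledGraph U} (ψ : Isos X Y) (χ : Isos Y Z) : Isos X Z :=
  ⟨ψ.1.trans χ.1, by rw [RelIso.trans_apply, ψ.2.1, χ.2.1], fun v => by
    rw [RelIso.trans_apply, ψ.2.2, χ.2.2]⟩

lemma Isom.symm {X : RootedLabelledGraph V} {Y : RootedLabelledGraph W} (h : X.Isom Y) :
    Y.Isom X := by
  obtain ⟨ψ⟩ := isom_iff_nonempty.1 h
  exact isom_iff_nonempty.2 ⟨ψ.symm⟩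

instance [Finite V] (X : RootedLabelledGraph V) : Finite (Isos X X) :=
  Finite.of_injective (fun ψ : Isos X X => (ψ.1 : V → V)) fun _ _ h =>
    Subtype.ext (DFunLike.coe_injective h)

instance (X : RootedLabelledGraph V) : Nonempty (Isos X X) :=
  ⟨⟨RelIso.refl _, rfl, fun _ => rfl⟩⟩

open Classical in
-- Composition with one fixed isomorphism identifies the isomorphisms with the automorphisms of `X`.
lemma card_isos (X : RootedLabelledGraph V) (Y : RootedLabelledGraph W) :
    Nat.card (Isos X Y) = if Y.Isom X then Nat.card (Isos X X) else 0 := by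
  split_ifs with h
  · obtain ⟨ψ⟩ := isom_iff_nonempty.1 h
    refine Nat.card_congr ⟨fun χ => χ.trans ψ, fun χ => χ.trans ψ.symm, fun χ => ?_, fun χ => ?_⟩
    · exact Subtype.ext (RelIso.ext fun v => ψ.1.symm_apply_apply _)
    · exact Subtype.ext (RelIso.ext fun v => ψ.1.apply_symm_apply _)
  · have : IsEmpty (Isos X Y) :=
      not_nonempty_iff.1 fun h' => h (isom_iff_nonempty.2 h').symm
    exact Nat.card_of_isEmpty

namespace ParentMap

variable {X : RootedLabelledGraph W} {t : ℕ} (P : X.ParentMap t)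

/-- `φ` maps `X` isomorphically onto the ball of radius `t` around the image of the root in the
graph `G` with labels `σ`. -/
structure IsCopy (G : SimpleGraph V) (σ : V → ℤˣ) (φ : W → V) : Prop where
  injective : Function.Injective φ
  label : ∀ w, σ (φ w) = X.label w
  adj_iff : ∀ u w, G.Adj (φ u) (φ w) ↔ X.graph.Adj u w
  closed : ∀ u, P.depth u < t → ∀ z, G.Adj (φ u) z → ∃ w, φ w = z

lemma depth_induction {p : W → Prop} (root : p X.root)
    (step : ∀ w, w ≠ X.root → p (P.parent w) → p w) (w : W) : p w := by
  have : ∀ d w, P.depth w = d → p w := by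
    intro d
    induction d with
    | zero =>
      intro w hw
      by_cases h : w = X.root
      · rwa [h]
      · have := P.depth_parent w h
        omega
    | succ d ih =>
      intro w hw
      have h : w ≠ X.root := by
        rintro rfl
        rw [P.depth_root] at hw
        omega
      exact step w h (ih _ (by have := P.depth_parent w h; omega))
  exact this _ w rfl

lemma adj_parent {w : W} (hw : w ≠ X.root) : X.graph.Adj (P.parent w) w :=
  (P.adj_iff _ _).2 (Or.inl ⟨hw, rfl⟩)

lemma depth_parent_lt {w : W} (hw : w ≠ X.root) : P.depth (P.parent w) < t := by
  have := P.depth_parent w hw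
  have := P.depth_le w
  omega

lemma depth_le_of_adj {u w : W} (h : X.graph.Adj u w) : P.depth w ≤ P.depth u + 1 := by
  rcases (P.adj_iff u w).1 h with ⟨hw, rfl⟩ | ⟨hu, rfl⟩
  · exact (P.depth_parent w hw).ge
  · have := P.depth_parent u hu
    omega

lemma edist_le {G : SimpleGraph V} {φ : W → V} (h : ∀ u w, X.graph.Adj u w → G.Adj (φ u) (φ w))
    (w : W) : G.edist (φ X.root) (φ w) ≤ P.depth w := by
  refine P.depth_induction (p := fun w => G.edist (φ X.root) (φ w) ≤ P.depth w) ?_ ?_ w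
  · simp
  · intro w hw ih
    have h1 : G.edist (φ (P.parent w)) (φ w) = 1 :=
      SimpleGraph.edist_eq_one_iff_adj.2 (h _ _ (P.adj_parent hw))
    calc G.edist (φ X.root) (φ w) ≤ _ + _ := SimpleGraph.edist_triangle
      _ ≤ P.depth (P.parent w) + 1 := by rw [h1]; gcongr
      _ = P.depth w := by rw [← P.depth_parent w hw]; simp

/-- Each step of the walk raises the depth by at most one, so every step starts at depth less than
`t`, where `closed` keeps it inside the image. -/
lemma exists_depth_le_of_walk {G : SimpleGraph V} {σ : V → ℤˣ} {φ : W → V} (h : P.IsCopy G σ φ)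
    {u : W} {z : V} (p : G.Walk (φ u) z) (hp : P.depth u + p.length ≤ t) : ∃ w, φ w = z := by
  generalize hx : φ u = x at p
  induction p generalizing u with
  | nil => exact ⟨u, hx⟩
  | @cons a b c hab p ih =>
    subst hx
    rw [SimpleGraph.Walk.length_cons] at hp
    obtain ⟨w, rfl⟩ := h.closed u (by omega) b hab
    have := P.depth_le_of_adj ((h.adj_iff _ _).1 hab)
    exact ih (u := w) rfl (by omega)

lemma mem_range_iff {Y : RootedLabelledGraph V} {φ : W → V} (h : P.IsCopy Y.graph Y.label φ)
    (hr : φ X.root = Y.root) (z : V) : (∃ w, φ w = z) ↔ Y.graph.edist Y.root z ≤ t := by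
  constructor
  · rintro ⟨w, rfl⟩
    rw [← hr]
    exact (P.edist_le (fun u w => (h.adj_iff u w).2) w).trans (by exact_mod_cast P.depth_le w)
  · intro hz
    obtain ⟨h1, h2⟩ := SimpleGraph.edist_le_iff_dist_le.1 hz
    obtain ⟨p, hp⟩ := h1.exists_walk_length_eq_dist
    refine P.exists_depth_le_of_walk h (p.copy hr.symm rfl) ?_
    rw [P.depth_root, SimpleGraph.Walk.length_copy]
    omega

/-- The copies of `X` in `Y` are the isomorphisms of `X` with a ball of `Y`. -/
noncomputable def copyEquiv (Y : RootedLabelledGraph V) :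
    Isos X (Y.nbhd t) ≃ {φ : W → V // P.IsCopy Y.graph Y.label φ ∧ φ X.root = Y.root} where
  toFun ψ := ⟨fun w => (ψ.1 w).1, by
    have hadj : ∀ u w, Y.graph.Adj (ψ.1 u).1 (ψ.1 w).1 ↔ X.graph.Adj u w := fun u w =>
      ψ.1.map_rel_iff (a := u) (b := w)
    have hroot : (ψ.1 X.root).1 = Y.root := congrArg Subtype.val ψ.2.1
    refine ⟨⟨fun u w h => ψ.1.injective (Subtype.ext h), fun w => (ψ.2.2 w).symm, hadj, ?_⟩, hroot⟩
    intro u hu z hz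
    have h1 : Y.graph.edist Y.root (ψ.1 u).1 ≤ P.depth u :=
      (congrArg (fun r => Y.graph.edist r (ψ.1 u).1) hroot).symm.trans_le
        (P.edist_le (φ := fun w => (ψ.1 w).1) (fun u w => (hadj u w).2) u)
    have h2 : Y.graph.edist Y.root z ≤ t := by
      calc Y.graph.edist Y.root z ≤ _ + _ := SimpleGraph.edist_triangle
        _ ≤ P.depth u + 1 := add_le_add h1 (SimpleGraph.edist_eq_one_iff_adj.2 hz).le
        _ ≤ t := by exact_mod_cast hu
    exact ⟨ψ.1.symm ⟨z, h2⟩, by simp⟩⟩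
  invFun φ := ⟨⟨Equiv.ofBijective (fun w => ⟨φ.1 w, (P.mem_range_iff φ.2.1 φ.2.2 _).1 ⟨w, rfl⟩⟩)
      ⟨fun u w h => φ.2.1.injective (congrArg Subtype.val h), fun z => by
        obtain ⟨w, hw⟩ := (P.mem_range_iff φ.2.1 φ.2.2 z.1).2 z.2
        exact ⟨w, Subtype.ext hw⟩⟩, fun {u w} => φ.2.1.adj_iff u w⟩,
    Subtype.ext φ.2.2, fun w => (φ.2.1.label w).symm⟩
  left_inv ψ := Subtype.ext (RelIso.ext fun w => rfl)
  right_inv φ := rfl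

open Classical in
lemma card_copies (Y : RootedLabelledGraph V) :
    Nat.card {φ : W → V // P.IsCopy Y.graph Y.label φ ∧ φ X.root = Y.root} =
      if (Y.nbhd t).Isom X then Nat.card (Isos X X) else 0 := by
  rw [← card_isos, Nat.card_congr (P.copyEquiv Y)]

end ParentMap

end RootedLabelledGraph

/-! ### Ulam–Harris addresses from orderings of the children -/

namespace RootedLabelledGraph.ParentMap

variable {W : Type*} {X : RootedLabelledGraph W} {t : ℕ} (P : X.ParentMap t)

/-- The type of a vertex relative to the type of its parent. -/
def rel (w : W) : ℤˣ := X.label w * X.label (P.parent w)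

lemma rel_mul (w : W) : P.rel w * X.label (P.parent w) = X.label w := by
  rw [rel, mul_assoc, Int.units_mul_self, mul_one]

/-- The children of `u` whose type is `s` times the type of `u`. -/
abbrev Kids (c : W × ℤˣ) : Type _ := {w : W // w ≠ X.root ∧ P.parent w = c.1 ∧ P.rel w = c.2}

/-- The number of children of `u` whose type is `s` times the type of `u`. -/
noncomputable def numKids (c : W × ℤˣ) : ℕ := Nat.card (P.Kids c)

/-- Orderings of the children of every vertex of each type. -/
abbrev Orders : Type _ := ∀ c : W × ℤˣ, P.Kids c ≃ Fin (P.numKids c)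

variable {P}

/-- The address of a vertex in the Ulam-Harris tree given by orderings of children. -/
noncomputable def address (h : P.Orders) (w : W) : List (ℤˣ × ℕ) :=
  open Classical in
  if hw : w = X.root then [] else
    (P.rel w, (h (P.parent w, P.rel w) ⟨w, hw, rfl, rfl⟩ : ℕ)) :: address h (P.parent w)
  termination_by P.depth w
  decreasing_by
    have := P.depth_parent w hw
    omega

lemma address_root (h : P.Orders) : address h X.root = [] := by
  rw [address, dif_pos rfl]

lemma address_of_ne (h : P.Orders) {w : W} (hw : w ≠ X.root) :
    address h w = (P.rel w, (h (P.parent w, P.rel w) ⟨w, hw, rfl, rfl⟩ : ℕ)) ::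
      address h (P.parent w) := by
  rw [address, dif_neg hw]

/-- Two indices with a propositional equality are allowed because the type of `h c` depends on `c`.
-/
lemma kid_ext (h : P.Orders) {c c' : W × ℤˣ} (hc : c = c') (w : P.Kids c) (w' : P.Kids c')
    (hw : (h c w : ℕ) = h c' w') : w.1 = w'.1 := by
  subst hc
  rw [(h c).injective (Fin.ext hw)]

lemma address_injective (h : P.Orders) : Function.Injective (address h) := by
  intro u
  refine P.depth_induction (p := fun u => ∀ w, address h u = address h w → u = w) ?_ ?_ u
  · intro w hw
    by_contra hne
    rw [address_root, address_of_ne h (Ne.symm hne)] at hw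
    simp at hw
  · intro u hu ih w huw
    by_cases hw : w = X.root
    · rw [hw, address_root, address_of_ne h hu] at huw
      simp at huw
    · rw [address_of_ne h hu, address_of_ne h hw, List.cons.injEq, Prod.mk.injEq] at huw
      obtain ⟨⟨h1, h2⟩, h3⟩ := huw
      exact kid_ext h (Prod.ext (ih _ h3) h1) ⟨u, _⟩ ⟨w, _⟩ h2

lemma type_address (h : P.Orders) (w : W) :
    GaltonWatson.type (X.label X.root) (address h w) = X.label w := by
  refine P.depth_induction
    (p := fun w => GaltonWatson.type (X.label X.root) (address h w) = X.label w) ?_ ?_ w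
  · simp [address_root, GaltonWatson.type]
  · intro w hw ih
    rw [address_of_ne h hw, GaltonWatson.type, ih, P.rel_mul]

/-- The root type and the offspring numbers on the vertices at depth less than `t` are those of
`X` with its children ordered by `h`. -/
def Occurs (h : P.Orders) (ω : ℤˣ × (List (ℤˣ × ℕ) → ℤˣ → ℕ)) : Prop :=
  ω.1 = X.label X.root ∧ ∀ u, P.depth u < t → ∀ s, ω.2 (address h u) s = P.numKids (u, s)

end RootedLabelledGraph.ParentMap

/-! ### Adjacency and finiteness in the Galton–Watson tree -/

namespace GaltonWatson

lemma tree_adj (ω : ℤˣ × (List (ℤˣ × ℕ) → ℤˣ → ℕ)) (a b : {u // Born ω.2 u}) :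
    (tree ω).graph.Adj a b ↔ (∃ x, b.1 = x :: a.1) ∨ ∃ x, a.1 = x :: b.1 := by
  rw [tree, SimpleGraph.fromRel_adj]
  refine ⟨fun h => h.2, fun h => ⟨?_, h⟩⟩
  rintro rfl
  rcases h with ⟨x, h⟩ | ⟨x, h⟩ <;> exact absurd (congrArg List.length h) (by simp)

lemma length_le_of_walk (ω : ℤˣ × (List (ℤˣ × ℕ) → ℤˣ → ℕ)) {a b : {u // Born ω.2 u}}
    (p : (tree ω).graph.Walk a b) : b.1.length ≤ a.1.length + p.length := by
  induction p with
  | nil => simp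
  | @cons a c b h p ih =>
    rw [SimpleGraph.Walk.length_cons]
    have : c.1.length ≤ a.1.length + 1 := by
      rcases (tree_adj ω a c).1 h with ⟨x, h⟩ | ⟨x, h⟩
      · rw [h, List.length_cons]
      · rw [h, List.length_cons]
        omega
    omega

lemma finite_born (N : List (ℤˣ × ℕ) → ℤˣ → ℕ) (k : ℕ) :
    {u | Born N u ∧ u.length ≤ k}.Finite := by
  induction k with
  | zero =>
    refine (Set.finite_singleton []).subset ?_
    rintro u ⟨-, hu⟩
    simpa using hu
  | succ k ih =>
    have hfin : ((⋃ u ∈ {u | Born N u ∧ u.length ≤ k}, ⋃ s : ℤˣ,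
        (fun i => (s, i) :: u) '' Set.Iio (N u s)) ∪ {[]}).Finite :=
      (ih.biUnion fun u _ => Set.finite_iUnion fun s => (Set.finite_Iio _).image _).union
        (Set.finite_singleton _)
    refine hfin.subset ?_
    rintro (_ | ⟨x, u⟩) ⟨hu, hl⟩
    · exact Or.inr rfl
    · left
      refine Set.mem_biUnion (x := u) ⟨hu.1, by simpa using hl⟩ ?_
      exact Set.mem_iUnion.2 ⟨x.1, x.2, hu.2, rfl⟩

/-- A step along an edge lengthens the address by at most one, so the ball lies among the finitely
many born addresses of length at most `t`. -/
lemma finite_nbhd (ω : ℤˣ × (List (ℤˣ × ℕ) → ℤˣ → ℕ)) (t : ℕ) :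
    Finite {v // (tree ω).graph.edist (tree ω).root v ≤ (t : ℕ∞)} := by
  have := (finite_born ω.2 t).to_subtype
  refine Finite.of_injective
    (β := {u | Born ω.2 u ∧ u.length ≤ t}) (fun v => ⟨v.1.1, v.1.2, ?_⟩) ?_
  · obtain ⟨h1, h2⟩ := SimpleGraph.edist_le_iff_dist_le.1 v.2
    obtain ⟨p, hp⟩ := h1.exists_walk_length_eq_dist
    have := length_le_of_walk ω p
    have h0 : (tree ω).root.1.length = 0 := rfl
    omega
  · intro v w h
    exact Subtype.ext (Subtype.ext (congrArg (fun z => z.1) h))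

end GaltonWatson

/-! ### Copies in the Galton–Watson tree correspond to orderings -/

namespace RootedLabelledGraph.ParentMap

open GaltonWatson

variable {W : Type*} {X : RootedLabelledGraph W} {t : ℕ} {P : X.ParentMap t}
  {ω : ℤˣ × (List (ℤˣ × ℕ) → ℤˣ → ℕ)}

lemma Occurs.born {h : P.Orders} (ho : Occurs h ω) (w : W) : Born ω.2 (address h w) := by
  refine P.depth_induction (p := fun w => Born ω.2 (address h w)) ?_ ?_ w
  · rw [address_root]
    trivial
  · intro w hw ih
    rw [address_of_ne h hw]
    refine ⟨ih, ?_⟩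
    rw [ho.2 _ (P.depth_parent_lt hw)]
    exact Fin.is_lt _

/-- Closedness is where the offspring numbers enter: a born child of an inner vertex has an index
below `numKids`, and `h` is onto these indices. -/
lemma Occurs.isCopy {h : P.Orders} (ho : Occurs h ω) :
    P.IsCopy (tree ω).graph (tree ω).label fun w => ⟨address h w, ho.born w⟩ := by
  have key : ∀ u w, (∃ x, address h w = x :: address h u) ↔ w ≠ X.root ∧ P.parent w = u := by
    intro u w
    constructor
    · rintro ⟨x, hx⟩
      have hw : w ≠ X.root := by
        rintro rfl
        rw [address_root] at hx
        simp at hx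
      rw [address_of_ne h hw, List.cons.injEq] at hx
      exact ⟨hw, address_injective h hx.2⟩
    · rintro ⟨hw, rfl⟩
      exact ⟨_, address_of_ne h hw⟩
  refine ⟨fun u w huw => address_injective h (congrArg Subtype.val huw), fun w => ?_,
    fun u w => ?_, fun u hu z hz => ?_⟩
  · change type ω.1 (address h w) = _
    rw [ho.1, type_address]
  · rw [tree_adj, P.adj_iff, key, key]
  · rw [tree_adj] at hz
    rcases hz with ⟨x, hx⟩ | ⟨x, hx⟩
    · have hb := z.2
      rw [hx] at hb
      have hlt : x.2 < P.numKids (u, x.1) := by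
        rw [← ho.2 u hu]
        exact hb.2
      obtain ⟨⟨w, hw, hpw, hrw⟩, hwx⟩ := (h (u, x.1)).surjective ⟨x.2, hlt⟩
      refine ⟨w, Subtype.ext ?_⟩
      simp only at hpw hrw ⊢
      subst hpw
      rw [hx, address_of_ne h hw]
      congr 1
      refine Prod.ext hrw ?_
      simp only
      obtain ⟨x1, x2⟩ := x
      simp only at hrw
      subst hrw
      rw [hwx]
    · have hu' : u ≠ X.root := by
        rintro rfl
        simp only [address_root] at hx
        simp at hx
      refine ⟨P.parent u, Subtype.ext ?_⟩
      simp only [address_of_ne h hu', List.cons.injEq] at hx ⊢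
      exact hx.2

section OfCopy

variable {φ : W → {u // Born ω.2 u}}

/-- Copies respect parents. Otherwise the image of `P.parent w` would be a child of the image of
`w`; but by induction it is a child of the image of its own parent, so `w` would be its own
grandparent. -/
lemma copy_parent (hφ : P.IsCopy (tree ω).graph (tree ω).label φ)
    (hr : φ X.root = (tree ω).root) (w : W) : (φ w).1.length = P.depth w ∧
    (w ≠ X.root → ∃ x, (φ w).1 = x :: (φ (P.parent w)).1) := by
  refine P.depth_induction (p := fun w => (φ w).1.length = P.depth w ∧
    (w ≠ X.root → ∃ x, (φ w).1 = x :: (φ (P.parent w)).1)) ?_ ?_ w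
  · simp [hr, P.depth_root, tree]
  · intro w hw ih
    have hx : ∃ x, (φ w).1 = x :: (φ (P.parent w)).1 := by
      rcases (tree_adj ω _ _).1 ((hφ.adj_iff _ _).2 (P.adj_parent hw)) with hx | ⟨x, hx⟩
      · exact hx
      · exfalso
        have hp : P.parent w ≠ X.root := by
          intro hp
          rw [hp, hr] at hx
          simp [tree] at hx
        obtain ⟨y, hy⟩ := ih.2 hp
        rw [hx, List.cons.injEq] at hy
        have h1 := hφ.injective (Subtype.ext hy.2)
        have h2 := P.depth_parent w hw
        have h3 := P.depth_parent _ hp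
        rw [← h1] at h3
        omega
    refine ⟨?_, fun _ => hx⟩
    obtain ⟨x, hx⟩ := hx
    rw [hx, List.length_cons, ih.1, P.depth_parent w hw]

lemma copy_eq_rel_cons (hφ : P.IsCopy (tree ω).graph (tree ω).label φ)
    (hr : φ X.root = (tree ω).root) {w : W} (hw : w ≠ X.root) :
    ∃ i, (φ w).1 = (P.rel w, i) :: (φ (P.parent w)).1 ∧ i < ω.2 (φ (P.parent w)).1 (P.rel w) := by
  obtain ⟨x, hx⟩ := (copy_parent hφ hr w).2 hw
  have h1 := hφ.label w
  have h2 := hφ.label (P.parent w)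
  change type ω.1 _ = _ at h1 h2
  rw [hx, type, h2, ← P.rel_mul w] at h1
  have h3 : x.1 = P.rel w := mul_right_cancel h1
  have hb := (φ w).2
  rw [hx] at hb
  refine ⟨x.2, by rw [hx, ← h3], ?_⟩
  rw [← h3]
  exact hb.2

/-- The ordering is read off from the copy: the position of a child `w` is the index at the head of
the address `φ w`. Closedness makes these indices exhaust all born children. -/
lemma exists_orders [Finite W] (hφ : P.IsCopy (tree ω).graph (tree ω).label φ)
    (hr : φ X.root = (tree ω).root) : ∃ h : P.Orders, Occurs h ω ∧ ∀ w, (φ w).1 = address h w := by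
  classical
  choose! i hi hlt using fun w (hw : w ≠ X.root) => copy_eq_rel_cons hφ hr hw
  let f : ∀ c : W × ℤˣ, P.Kids c → Fin (ω.2 (φ c.1).1 c.2) := fun c w =>
    ⟨i w.1, by
      have := hlt w.1 w.2.1
      rwa [w.2.2.1, w.2.2.2] at this⟩
  have hf : ∀ c, P.depth c.1 < t → Function.Bijective (f c) := by
    rintro ⟨u, s⟩ hu
    constructor
    · intro w w' hww
      have h1 := hi w.1 w.2.1
      have h2 := hi w'.1 w'.2.1
      have h3 : i w.1 = i w'.1 := congrArg Fin.val hww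
      rw [w.2.2.1, w.2.2.2, h3] at h1
      rw [w'.2.2.1, w'.2.2.2] at h2
      exact Subtype.ext (hφ.injective (Subtype.ext (h1.trans h2.symm)))
    · intro j
      have hb : Born ω.2 ((s, (j : ℕ)) :: (φ u).1) := ⟨(φ u).2, j.2⟩
      obtain ⟨w, hw⟩ := hφ.closed u hu ⟨_, hb⟩ ((tree_adj _ _ _).2 (Or.inl ⟨_, rfl⟩))
      have hw' : (φ w).1 = (s, (j : ℕ)) :: (φ u).1 := congrArg Subtype.val hw
      have hlen : P.depth w = P.depth u + 1 := by
        rw [← (copy_parent hφ hr w).1, ← (copy_parent hφ hr u).1, hw', List.length_cons]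
      have hwr : w ≠ X.root := by
        rintro rfl
        rw [P.depth_root] at hlen
        omega
      have h1 := hi w hwr
      rw [hw', List.cons.injEq, Prod.mk.injEq] at h1
      exact ⟨⟨w, hwr, (hφ.injective (Subtype.ext h1.2)).symm, h1.1.1.symm⟩, Fin.ext h1.1.2.symm⟩
  have hcard : ∀ c, P.depth c.1 < t → ω.2 (φ c.1).1 c.2 = P.numKids c := by
    intro c hc
    rw [numKids, Nat.card_congr (Equiv.ofBijective _ (hf c hc)), Nat.card_fin]
  -- From depth `t` on there are no children, so the default value orders an empty set.
  let h : P.Orders := fun c =>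
    if hc : P.depth c.1 < t then (Equiv.ofBijective _ (hf c hc)).trans (finCongr (hcard c hc))
    else Finite.equivFin _
  have hpos : ∀ c (hc : P.depth c.1 < t),
      h c = (Equiv.ofBijective _ (hf c hc)).trans (finCongr (hcard c hc)) := fun c hc => dif_pos hc
  have haddr : ∀ w, (φ w).1 = address h w := by
    intro w
    refine P.depth_induction (p := fun w => (φ w).1 = address h w) ?_ ?_ w
    · rw [address_root, hr]
      rfl
    · intro w hw ih
      rw [address_of_ne h hw, ← ih, hi w hw]
      congr 2
      rw [hpos (P.parent w, P.rel w) (P.depth_parent_lt hw)]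
      rfl
  refine ⟨h, ⟨?_, fun u hu s => ?_⟩, haddr⟩
  · have := hφ.label X.root
    rw [hr] at this
    exact this
  · rw [← haddr]
    exact hcard (u, s) hu

end OfCopy

lemma address_ext {h h' : P.Orders} (hh : ∀ w, address h w = address h' w) : h = h' := by
  funext c
  ext w
  obtain ⟨w, hw, h1, h2⟩ := w
  have hc : c = (P.parent w, P.rel w) := Prod.ext h1.symm h2.symm
  subst hc
  have := hh w
  rw [address_of_ne h hw, address_of_ne h' hw, List.cons.injEq, Prod.mk.injEq] at this
  exact this.1.2

variable (P) in
open Classical in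
-- Sending an ordering to its address map is a bijection onto the copies of `X` at the root of the
-- tree; injectivity is `address_ext` and surjectivity is `exists_orders`.
lemma card_occurs [Finite W] (ω : ℤˣ × (List (ℤˣ × ℕ) → ℤˣ → ℕ)) :
    Nat.card {h : P.Orders // Occurs h ω} =
      if ((tree ω).nbhd t).Isom X then Nat.card (Isos X X) else 0 := by
  rw [← P.card_copies (tree ω)]
  refine Nat.card_congr (Equiv.ofBijective
    (fun h => ⟨fun w => ⟨address h.1 w, h.2.born w⟩, h.2.isCopy,
      Subtype.ext (address_root h.1)⟩) ⟨?_, ?_⟩)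
  · intro h h' hh
    refine Subtype.ext (address_ext fun w => ?_)
    exact congrArg (fun f => (f.1 w).1) hh
  · rintro ⟨φ, hφ, hr⟩
    obtain ⟨h, ho, hh⟩ := exists_orders hφ hr
    exact ⟨⟨h, ho⟩, Subtype.ext (funext fun w => Subtype.ext (hh w).symm)⟩

end RootedLabelledGraph.ParentMap

instance : MeasurableSingletonClass ℤˣ :=
  ⟨fun a => ⟨{(a : ℤ)}, MeasurableSet.singleton _, by ext b; simp [Units.ext_iff]⟩⟩

/-! ### The law of the ball of the Galton–Watson tree -/

namespace RootedLabelledGraph.ParentMap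

open GaltonWatson

variable {W : Type*} {X : RootedLabelledGraph W} {t : ℕ} (P : X.ParentMap t)

/-- The number of vertices at depth less than `t`. -/
noncomputable def numInner [Fintype W] : ℕ := (Finset.univ.filter fun u => P.depth u < t).card

/-- The expected number of copies of `X` in the Galton-Watson tree. -/
noncomputable def copyDensity [Fintype W] [DecidableEq W] (dPos dNeg : ℝ≥0) : ℝ :=
  1 / 2 * (∏ w ∈ Finset.univ.erase X.root, ((if P.rel w = 1 then dPos else dNeg : ℝ≥0) : ℝ)) *
    Real.exp (-((dPos : ℝ) + dNeg)) ^ P.numInner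

instance [Finite W] : Finite P.Orders :=
  Finite.of_injective (fun h : P.Orders => fun c (w : P.Kids c) => (⟨c, h c w⟩ :
    Σ c, Fin (P.numKids c))) fun h h' hh => by
      funext c
      ext w
      have := congrFun (congrFun hh c) w
      simpa [Fin.ext_iff] using this

lemma card_orders [Fintype W] [DecidableEq W] :
    Nat.card P.Orders = ∏ c : W × ℤˣ, (P.numKids c).factorial := by
  classical
  rw [Nat.card_pi]
  refine Finset.prod_congr rfl fun c _ => ?_
  have e : P.Kids c ≃ Fin (P.numKids c) := Finite.equivFin _
  rw [Nat.card_congr (Equiv.equivCongr e (Equiv.refl _)), Nat.card_perm, Nat.card_fin]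

/-- A finite cylinder, the form in which the infinite product measure can be evaluated. Quantifying
over all `u` with address `l` avoids inverting `address h`. -/
lemma occurs_set_eq [Fintype W] {P : X.ParentMap t} (h : P.Orders) :
    {ω | Occurs h ω} = {X.label X.root} ×ˢ Set.pi
      (((Finset.univ.filter fun u => P.depth u < t).map ⟨address h, address_injective h⟩ :
        Finset (List (ℤˣ × ℕ))) : Set (List (ℤˣ × ℕ)))
      (fun l => {N : ℤˣ → ℕ | ∀ u, address h u = l → ∀ s, N s = P.numKids (u, s)}) := by
  ext ω
  simp only [Occurs, Set.mem_ofPred_eq, Set.mem_prod, Set.mem_singleton_iff, Set.mem_pi,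
    Finset.mem_coe, Finset.mem_map, Finset.mem_filter, Finset.mem_univ, true_and,
    Function.Embedding.coeFn_mk]
  refine and_congr_right fun _ => ⟨?_, ?_⟩
  · rintro H l ⟨u, hu, rfl⟩ u' hu' s
    rw [← hu']
    rw [← address_injective h hu'] at hu
    exact H u' hu s
  · intro H u hu s
    exact H _ ⟨u, hu, rfl⟩ u rfl s

lemma measurableSet_occurs [Fintype W] {P : X.ParentMap t} (h : P.Orders) :
    MeasurableSet {ω | Occurs h ω} := by
  rw [occurs_set_eq]
  refine (MeasurableSet.singleton _).prod (MeasurableSet.pi (Finset.countable_toSet _) fun l _ => ?_)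
  exact DiscreteMeasurableSpace.forall_measurableSet _

lemma law_occurs [Fintype W] {P : X.ParentMap t} (h : P.Orders) (dPos dNeg : ℝ≥0) :
    (law dPos dNeg) {ω | Occurs h ω} = 2⁻¹ * ∏ u ∈ Finset.univ.filter fun u => P.depth u < t,
      ∏ s : ℤˣ, poissonMeasure (if s = 1 then dPos else dNeg) {P.numKids (u, s)} := by
  have h1 : uniformOn (Set.univ : Set ℤˣ) {X.label X.root} = 2⁻¹ := by
    rw [uniformOn_univ]
    simp
  rw [occurs_set_eq, law, Measure.prod_prod, h1, Measure.infinitePi_pi, Finset.prod_map]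
  · congr 1
    refine Finset.prod_congr rfl fun u _ => ?_
    rw [← Measure.pi_pi]
    congr 1
    ext N
    simp only [Function.Embedding.coeFn_mk, Set.mem_ofPred_eq, Set.mem_pi, Set.mem_univ,
      Set.mem_singleton_iff, forall_const]
    exact ⟨fun H => H u rfl, fun H u' hu' => by rwa [address_injective h hu']⟩
  · exact fun l _ => DiscreteMeasurableSpace.forall_measurableSet _

instance (dPos dNeg : ℝ≥0) : IsProbabilityMeasure (law dPos dNeg) := by
  have : IsProbabilityMeasure (uniformOn (Set.univ : Set ℤˣ)) :=
    isProbabilityMeasure_uniformOn Set.finite_univ Set.univ_nonempty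
  unfold law
  infer_instance

/-- The events on the right overlap: each tree whose ball is isomorphic to `X` lies in exactly `|Aut
X|` of them. The identity is `card_occurs` integrated over `ω`. -/
lemma card_isos_mul_law [Fintype W] (dPos dNeg : ℝ≥0) [Fintype P.Orders] :
    (Nat.card (Isos X X) : ℝ≥0∞) * law dPos dNeg {ω | ((tree ω).nbhd t).Isom X} =
      ∑ h : P.Orders, law dPos dNeg {ω | Occurs h ω} := by
  classical
  have hset : {ω | ((tree ω).nbhd t).Isom X} = ⋃ h : P.Orders, {ω | Occurs h ω} := by
    ext ω
    have h1 := P.card_occurs ω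
    have h2 : 0 < Nat.card (Isos X X) := Nat.card_pos
    rw [Set.mem_iUnion, Set.mem_ofPred_eq]
    constructor
    · intro h
      rw [if_pos h] at h1
      rw [← h1] at h2
      obtain ⟨h⟩ := (Nat.card_pos_iff.1 h2).1
      exact ⟨h.1, h.2⟩
    · rintro ⟨h, ho⟩
      by_contra hn
      rw [if_neg hn, Nat.card_eq_zero] at h1
      rcases h1 with h1 | h1
      · exact h1.false ⟨h, ho⟩
      · exact h1.not_finite inferInstance
  have hmeas : MeasurableSet {ω | ((tree ω).nbhd t).Isom X} := by
    rw [hset]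
    exact MeasurableSet.iUnion fun h => measurableSet_occurs h
  calc (Nat.card (Isos X X) : ℝ≥0∞) * law dPos dNeg {ω | ((tree ω).nbhd t).Isom X}
      = ∫⁻ ω, (Nat.card (Isos X X) : ℝ≥0∞) * Set.indicator {ω | ((tree ω).nbhd t).Isom X} 1 ω
        ∂law dPos dNeg := by
        rw [lintegral_const_mul _ (measurable_one.indicator hmeas), lintegral_indicator_one hmeas]
    _ = ∫⁻ ω, ∑ h : P.Orders, Set.indicator {ω | Occurs h ω} 1 ω ∂law dPos dNeg := by
        refine lintegral_congr fun ω => ?_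
        have h1 := P.card_occurs ω
        rw [Nat.card_eq_fintype_card, Fintype.card_subtype] at h1
        simp only [Set.indicator_apply, Set.mem_ofPred_eq, Pi.one_apply, Finset.sum_boole, h1]
        split_ifs <;> simp
    _ = ∑ h : P.Orders, law dPos dNeg {ω | Occurs h ω} := by
        rw [lintegral_finsetSum]
        · exact Finset.sum_congr rfl fun h _ => lintegral_indicator_one (measurableSet_occurs h)
        · exact fun h _ => measurable_one.indicator (measurableSet_occurs h)

/-- The vertices other than the root are grouped by their parent and their relative type. -/
lemma prod_pow_numKids [Fintype W] [DecidableEq W] (d : ℤˣ → ℝ) :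
    ∏ u ∈ Finset.univ.filter fun u => P.depth u < t, ∏ s : ℤˣ, d s ^ P.numKids (u, s) =
      ∏ w ∈ Finset.univ.erase X.root, d (P.rel w) := by
  rw [← Finset.prod_product', ← Finset.prod_fiberwise_of_maps_to (s := Finset.univ.erase X.root)
    (t := (Finset.univ.filter fun u => P.depth u < t) ×ˢ Finset.univ)
    (g := fun w => (P.parent w, P.rel w))]
  · refine Finset.prod_congr rfl fun c _ => ?_
    rw [Finset.prod_congr rfl (g := fun _ => d c.2), Finset.prod_const]
    · congr 1
      rw [numKids, Nat.card_eq_fintype_card, Fintype.card_subtype]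
      congr 1
      ext w
      simp [Prod.ext_iff]
    · intro w hw
      rw [← (Finset.mem_filter.1 hw).2]
  · intro w hw
    simp only [Finset.mem_product, Finset.mem_filter, Finset.mem_univ, true_and, and_true]
    exact P.depth_parent_lt (Finset.mem_erase.1 hw).1

lemma numKids_of_not_inner {u : W} (hu : ¬ P.depth u < t) (s : ℤˣ) : P.numKids (u, s) = 0 := by
  have : IsEmpty (P.Kids (u, s)) := by
    refine ⟨fun w => hu ?_⟩
    have := P.depth_parent_lt w.2.1
    rwa [w.2.2.1] at this
  exact Nat.card_of_isEmpty

/-- The probability that the ball of radius `t` in the Galton-Watson tree is isomorphic to `X`. -/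
lemma card_isos_mul_law_real [Fintype W] [DecidableEq W] (dPos dNeg : ℝ≥0) :
    (Nat.card (Isos X X) : ℝ) * (law dPos dNeg).real {ω | ((tree ω).nbhd t).Isom X} =
      P.copyDensity dPos dNeg := by
  classical
  have : Fintype P.Orders := Fintype.ofFinite _
  have h1 := congrArg ENNReal.toReal (P.card_isos_mul_law dPos dNeg)
  rw [ENNReal.toReal_mul, ENNReal.toReal_natCast] at h1
  rw [measureReal_def, h1]
  simp only [law_occurs]
  rw [Finset.sum_const, Finset.card_univ, ← Nat.card_eq_fintype_card, card_orders,
    nsmul_eq_mul, ENNReal.toReal_mul, ENNReal.toReal_mul, ENNReal.toReal_natCast,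
    ENNReal.toReal_prod, ENNReal.toReal_inv]
  simp only [ENNReal.toReal_prod, ← measureReal_def, poissonMeasure_real_singleton]
  -- Vertices at depth `t` contribute `0! = 1`, so the number of orderings is exactly the product of
  -- the Poisson denominators.
  have h2 : (∏ c : W × ℤˣ, (P.numKids c).factorial) =
      ∏ u ∈ Finset.univ.filter fun u => P.depth u < t, ∏ s : ℤˣ, (P.numKids (u, s)).factorial := by
    rw [← Finset.univ_product_univ, Finset.prod_product, Finset.prod_filter]
    refine Finset.prod_congr rfl fun u _ => ?_
    split_ifs with hu
    · rfl
    · simp [P.numKids_of_not_inner hu]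
  have h3 : ∀ u, (∏ s : ℤˣ, (Real.exp (-((if s = 1 then dPos else dNeg : ℝ≥0) : ℝ)) *
      ((if s = 1 then dPos else dNeg : ℝ≥0) : ℝ) ^ P.numKids (u, s) /
        ((P.numKids (u, s)).factorial : ℝ))) = Real.exp (-((dPos : ℝ) + dNeg)) *
      (∏ s : ℤˣ, ((if s = 1 then dPos else dNeg : ℝ≥0) : ℝ) ^ P.numKids (u, s)) /
        ∏ s : ℤˣ, ((P.numKids (u, s)).factorial : ℝ) := by
    intro u
    rw [Finset.prod_div_distrib, Finset.prod_mul_distrib]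
    congr 2
    rw [show (Finset.univ : Finset ℤˣ) = {1, -1} from rfl, Finset.prod_pair (by decide),
      if_pos rfl, if_neg (by decide), ← Real.exp_add]
    congr 1
    ring
  simp only [h3]
  rw [Finset.prod_div_distrib, Finset.prod_mul_distrib, Finset.prod_const, prod_pow_numKids P
    (fun s => ((if s = 1 then dPos else dNeg : ℝ≥0) : ℝ)), h2]
  have h4 : (∏ u ∈ Finset.univ.filter fun u => P.depth u < t,
      ∏ s : ℤˣ, ((P.numKids (u, s)).factorial : ℝ)) ≠ 0 :=
    Finset.prod_ne_zero_iff.2 fun u _ => Finset.prod_ne_zero_iff.2 fun s _ =>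
      Nat.cast_ne_zero.2 (Nat.factorial_ne_zero _)
  push_cast
  rw [copyDensity, numInner]
  field_simp
  simp only [ENNReal.toReal_ofNat]
  ring

end RootedLabelledGraph.ParentMap

/-! ### Independent edge indicators and the expected number of dense sets -/

namespace PlantedBisection

section Counting

variable {Ω ι : Type*} [MeasurableSpace Ω] [Finite Ω] [DiscreteMeasurableSpace Ω]
  (μ : Measure Ω) [IsFiniteMeasure μ]

lemma integral_card_filter (s : Finset ι) (A : ι → Ω → Prop) [∀ i b, Decidable (A i b)] :
    ∫ b, ((s.filter fun i => A i b).card : ℝ) ∂μ = ∑ i ∈ s, μ.real {b | A i b} := by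
  have h1 : ∀ b, ((s.filter fun i => A i b).card : ℝ) =
      ∑ i ∈ s, Set.indicator {b | A i b} (1 : Ω → ℝ) b := by
    intro b
    classical
    simp [Set.indicator_apply]
  simp_rw [h1]
  rw [integral_finsetSum _ fun i _ => Integrable.of_finite]
  exact Finset.sum_congr rfl fun i _ =>
    integral_indicator_one (DiscreteMeasurableSpace.forall_measurableSet _)

end Counting

section EdgeMeasure

variable {V : Type*}

/-- The graph of all pairs whose indicator is true. -/
def graphOf (b : Sym2 V → Prop) : SimpleGraph V := SimpleGraph.fromEdgeSet {e | b e}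

lemma graphOf_adj {b : Sym2 V → Prop} {u w : V} : (graphOf b).Adj u w ↔ b s(u, w) ∧ u ≠ w := by
  rw [graphOf, SimpleGraph.fromEdgeSet_adj, Set.mem_ofPred_eq]

variable [Fintype V]

/-- Independent indicators for all pairs. -/
noncomputable def edgeMeasure (p : Sym2 V → unitInterval) : Measure (Sym2 V → Prop) :=
  Measure.pi fun e => bernoulliMeasure True False (p e)

instance (p : Sym2 V → unitInterval) : IsProbabilityMeasure (edgeMeasure p) := by
  unfold edgeMeasure
  infer_instance

variable (p : Sym2 V → unitInterval)

lemma edgeMeasure_real_present_absent {E F : Finset (Sym2 V)} (h : Disjoint E F) :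
    (edgeMeasure p).real {b | (∀ e ∈ E, b e) ∧ ∀ e ∈ F, ¬ b e} =
      (∏ e ∈ E, (p e : ℝ)) * ∏ e ∈ F, (1 - (p e : ℝ)) := by
  classical
  have h1 : {b : Sym2 V → Prop | (∀ e ∈ E, b e) ∧ ∀ e ∈ F, ¬ b e} =
      Set.univ.pi fun e => {a : Prop | (e ∈ E → a) ∧ (e ∈ F → ¬ a)} := by
    ext b
    simp [forall_and]
  rw [h1, edgeMeasure, measureReal_def, Measure.pi_pi, ENNReal.toReal_prod]
  simp_rw [← measureReal_def]
  have h2 : ∀ e, (bernoulliMeasure True False (p e)).real {a : Prop | (e ∈ E → a) ∧ (e ∈ F → ¬ a)} =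
      (if e ∈ E then (p e : ℝ) else 1) * if e ∈ F then (1 - (p e : ℝ)) else 1 := by
    intro e
    rw [bernoulliMeasure_real_apply _ (DiscreteMeasurableSpace.forall_measurableSet _)]
    by_cases hE : e ∈ E
    · have hF : e ∉ F := Finset.disjoint_left.1 h hE
      simp [hE, hF]
    · by_cases hF : e ∈ F <;> simp [hE, hF]
  simp_rw [h2]
  rw [Finset.prod_mul_distrib]
  simp [Finset.prod_ite_mem]

lemma edgeMeasure_real_present (E : Finset (Sym2 V)) :
    (edgeMeasure p).real {b | ∀ e ∈ E, b e} = ∏ e ∈ E, (p e : ℝ) := by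
  have := edgeMeasure_real_present_absent p (Finset.disjoint_empty_right E)
  simpa using this

/-- The nonempty sets of at most `K` vertices which span at least `j` edges more than a tree. -/
noncomputable def denseSets (G : SimpleGraph V) (K j : ℕ) : Finset (Finset V) :=
  open Classical in Finset.univ.filter fun S => S.Nonempty ∧ S.card ≤ K ∧ G.SpansEdges S (S.card - 1 + j)

lemma mem_denseSets {G : SimpleGraph V} {K j : ℕ} {S : Finset V} : S ∈ denseSets G K j ↔
    S.Nonempty ∧ S.card ≤ K ∧ G.SpansEdges S (S.card - 1 + j) := by
  simp [denseSets]

/-- A union bound over the `m`-element subsets of `S.sym2`, which has `(S.card + 1).choose 2`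
elements; the diagonal pairs in it only weaken the constant. -/
lemma edgeMeasure_real_spansEdges_le {q : ℝ} (hq : 0 ≤ q) (hp : ∀ e, (p e : ℝ) ≤ q) (S : Finset V)
    (m : ℕ) : (edgeMeasure p).real {b | (graphOf b).SpansEdges S m} ≤
      2 ^ (S.card + 1).choose 2 * q ^ m := by
  classical
  have hsub : {b | (graphOf b).SpansEdges S m} ⊆
      ⋃ E ∈ S.sym2.powersetCard m, {b | ∀ e ∈ E, b e} := by
    rintro b ⟨E, hE, hEc, hEb⟩
    refine Set.mem_biUnion (x := E) (Finset.mem_coe.2 (Finset.mem_powersetCard.2 ⟨hE, hEc⟩)) ?_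
    intro e he
    have := hEb e he
    rw [graphOf, SimpleGraph.edgeSet_fromEdgeSet] at this
    exact this.1
  calc _ ≤ (edgeMeasure p).real (⋃ E ∈ S.sym2.powersetCard m, {b | ∀ e ∈ E, b e}) :=
        measureReal_mono hsub (measure_ne_top _ _)
    _ ≤ ∑ E ∈ S.sym2.powersetCard m, (edgeMeasure p).real {b | ∀ e ∈ E, b e} :=
        measureReal_biUnion_finset_le _ _
    _ ≤ ∑ E ∈ S.sym2.powersetCard m, q ^ m := by
        refine Finset.sum_le_sum fun E hE => ?_
        rw [edgeMeasure_real_present, ← (Finset.mem_powersetCard.1 hE).2, ← Finset.prod_const]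
        exact Finset.prod_le_prod (fun e _ => (p e).2.1) fun e _ => hp e
    _ ≤ _ := by
        rw [Finset.sum_const, nsmul_eq_mul]
        refine mul_le_mul_of_nonneg_right ?_ (pow_nonneg hq m)
        rw [← Finset.card_sym2]
        have : (S.sym2.powersetCard m).card ≤ 2 ^ S.sym2.card := by
          rw [← Finset.card_powerset]
          exact Finset.card_le_card fun E hE =>
            Finset.mem_powerset.2 (Finset.mem_powersetCard.1 hE).1
        exact_mod_cast this

open Classical in
-- There are at most `n^k` sets of size `k`, each dense with probability `O(n^{-(k-1+j)})`, which
-- gives `O(n^{1-j})` for each of the `K` sizes. Only `j = 0` (meeting copies) and `j = 1` (cycles)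
-- are needed.
lemma integral_card_denseSets_le {D : ℝ} (hD : 1 ≤ D)
    (hp : ∀ e, (p e : ℝ) ≤ D / Fintype.card V) (K j : ℕ) :
    (Fintype.card V : ℝ) ^ j * ∫ b, ((denseSets (graphOf b) K j).card : ℝ) ∂edgeMeasure p ≤
      K * 2 ^ (K + 1).choose 2 * D ^ (K + j) * Fintype.card V := by
  set n : ℝ := ((Fintype.card V : ℕ) : ℝ) with hn
  have hn0 : 0 ≤ n := Nat.cast_nonneg (Fintype.card V)
  have h1 : ∀ b : Sym2 V → Prop, denseSets (graphOf b) K j =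
      (Finset.univ.filter fun S : Finset V => S.Nonempty ∧ S.card ≤ K).filter
        fun S => (graphOf b).SpansEdges S (S.card - 1 + j) := by
    intro b
    ext S
    simp only [denseSets, Finset.mem_filter, Finset.mem_univ, true_and, and_assoc]
  simp_rw [h1]
  rw [integral_card_filter]
  have hmaps : ∀ S ∈ (Finset.univ.filter fun S : Finset V => S.Nonempty ∧ S.card ≤ K),
      S.card ∈ Finset.Icc 1 K := by
    intro S hS
    have := (Finset.mem_filter.1 hS).2
    exact Finset.mem_Icc.2 ⟨Finset.card_pos.2 this.1, this.2⟩
  rw [← Finset.sum_fiberwise_of_maps_to hmaps, Finset.mul_sum]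
  have h2 : ∀ k ∈ Finset.Icc 1 K, n ^ j * ∑ S ∈ (Finset.univ.filter fun S : Finset V =>
      S.Nonempty ∧ S.card ≤ K).filter (fun S => S.card = k),
        (edgeMeasure p).real {b | (graphOf b).SpansEdges S (S.card - 1 + j)} ≤
      2 ^ (K + 1).choose 2 * D ^ (K + j) * n := by
    intro k hk
    obtain ⟨hk1, hkK⟩ := Finset.mem_Icc.1 hk
    have hq : 0 ≤ D / n := div_nonneg (by linarith) hn0
    calc _ ≤ n ^ j * ∑ S ∈ (Finset.univ.filter fun S : Finset V =>
          S.Nonempty ∧ S.card ≤ K).filter (fun S => S.card = k),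
            (2 ^ (K + 1).choose 2 * (D / n) ^ (k - 1 + j)) := by
          refine mul_le_mul_of_nonneg_left (Finset.sum_le_sum fun S hS => ?_) (by positivity)
          have hSk := (Finset.mem_filter.1 hS).2
          refine (edgeMeasure_real_spansEdges_le p hq hp S _).trans ?_
          rw [hSk]
          gcongr
          norm_num
      _ ≤ n ^ j * (n ^ k * (2 ^ (K + 1).choose 2 * (D / n) ^ (k - 1 + j))) := by
          rw [Finset.sum_const, nsmul_eq_mul]
          refine mul_le_mul_of_nonneg_left (mul_le_mul_of_nonneg_right ?_ (by positivity))
            (by positivity)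
          have h3 : ((Finset.univ.filter fun S : Finset V =>
              S.Nonempty ∧ S.card ≤ K).filter (fun S => S.card = k)).card ≤
              Fintype.card V ^ k := by
            refine le_trans (Finset.card_le_card (t := Finset.univ.powersetCard k) ?_) ?_
            · intro S hS
              exact Finset.mem_powersetCard.2 ⟨Finset.subset_univ _, (Finset.mem_filter.1 hS).2⟩
            · rw [Finset.card_powersetCard, Finset.card_univ]
              exact Nat.choose_le_pow _ _
          rw [hn]
          exact_mod_cast h3
      _ = 2 ^ (K + 1).choose 2 * ((n * (D / n)) ^ (k - 1 + j) * n) := by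
          rw [mul_pow]
          have : n ^ k = n ^ (k - 1) * n := by rw [← pow_succ]; congr 1; omega
          rw [this, pow_add n]
          ring
      _ ≤ 2 ^ (K + 1).choose 2 * (D ^ (K + j) * n) := by
          gcongr
          -- For `n = 0` the quotient `D / n` is `0` by convention and does not cancel.
          rcases hn0.eq_or_lt with h | h
          · rw [← h, zero_mul]
            exact (zero_pow_le_one _).trans (one_le_pow₀ hD)
          · rw [mul_div_cancel₀ _ h.ne']
            exact pow_le_pow_right₀ hD (by omega)
      _ = _ := by ring
  refine (Finset.sum_le_sum h2).trans_eq ?_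
  rw [Finset.sum_const, nsmul_eq_mul]
  rw [Nat.card_Icc, Nat.add_sub_cancel]
  ring

end EdgeMeasure

end PlantedBisection

set_option linter.unusedSectionVars false

/-! ### The probability that no edge leaves a set -/

namespace PlantedBisection

section OutPairs

variable {V : Type*} [Fintype V] [DecidableEq V]

/-- The pairs of a vertex in `U` and a vertex outside `R`. -/
def outPairs (U R : Finset V) : Finset (Sym2 V) := (U ×ˢ Rᶜ).image fun a => s(a.1, a.2)

/-- Since `U` lies inside `R`, an unordered pair reveals which end is in `U`, so no pair is counted
twice. -/
lemma prod_outPairs {U R : Finset V} (hUR : U ⊆ R) (f : Sym2 V → ℝ) :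
    ∏ e ∈ outPairs U R, f e = ∏ u ∈ U, ∏ z ∈ Rᶜ, f s(u, z) := by
  rw [outPairs, Finset.prod_image, Finset.prod_product]
  rintro ⟨u, z⟩ h1 ⟨u', z'⟩ h2 h12
  have h1 := Finset.mem_product.1 (Finset.mem_coe.1 h1)
  have h2 := Finset.mem_product.1 (Finset.mem_coe.1 h2)
  simp only [Finset.mem_compl] at h1 h2
  rcases Sym2.eq_iff.1 h12 with h | h
  · exact Prod.ext h.1 h.2
  · have h3 : u = z' := h.1
    exact absurd (hUR h1.1) (h3 ▸ h2.2)

lemma disjoint_sym2_outPairs (U R : Finset V) : Disjoint R.sym2 (outPairs U R) := by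
  rw [Finset.disjoint_left]
  intro e he he'
  obtain ⟨⟨u, z⟩, hz, rfl⟩ := Finset.mem_image.1 he'
  have := (Finset.mem_product.1 hz).2
  exact Finset.mem_compl.1 this (Finset.mk_mem_sym2_iff.1 he).2

variable (σ : V → ℤˣ) (ρ : ℤˣ → unitInterval)

/-- The probability `ρ 1` for pairs inside the classes of `σ` and `ρ (-1)` for the other pairs. -/
def pairProb (e : Sym2 V) : unitInterval := ρ (e.map σ).mul

lemma pairProb_mk (u w : V) : pairProb σ ρ s(u, w) = ρ (σ u * σ w) := by
  rw [pairProb, Sym2.map_mk, Sym2.mul_mk]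

/-- The probability that a vertex is adjacent to neither of two given vertices of different
classes. -/
noncomputable def noEdgeProb : ℝ := ∏ s : ℤˣ, (1 - (ρ s : ℝ))

lemma noEdgeProb_nonneg : 0 ≤ noEdgeProb ρ :=
  Finset.prod_nonneg fun s _ => sub_nonneg.2 (ρ s).2.2

lemma noEdgeProb_le (s : ℤˣ) : noEdgeProb ρ ≤ 1 - (ρ s : ℝ) := by
  rw [noEdgeProb, ← Finset.mul_prod_erase _ _ (Finset.mem_univ s)]
  refine mul_le_of_le_one_right (sub_nonneg.2 (ρ s).2.2) (Finset.prod_le_one ?_ ?_)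
  · exact fun s _ => sub_nonneg.2 (ρ s).2.2
  · exact fun s _ => sub_le_self _ (ρ s).2.1

lemma noEdgeProb_le_one : noEdgeProb ρ ≤ 1 :=
  (noEdgeProb_le ρ 1).trans (sub_le_self _ (ρ 1).2.1)

lemma prod_compl_eq (u : V) (R : Finset V) :
    ∏ z ∈ Rᶜ, (1 - (pairProb σ ρ s(u, z) : ℝ)) =
      ∏ s : ℤˣ, (1 - (ρ s : ℝ)) ^ (Rᶜ.filter fun z => σ u * σ z = s).card := by
  rw [← Finset.prod_fiberwise_of_maps_to (t := Finset.univ) (g := fun z => σ u * σ z)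
    fun _ _ => Finset.mem_univ _]
  refine Finset.prod_congr rfl fun s _ => ?_
  rw [← Finset.prod_const]
  refine Finset.prod_congr rfl fun z hz => ?_
  rw [pairProb_mk, (Finset.mem_filter.1 hz).2]

lemma filter_mul_eq (u : V) (s : ℤˣ) (R : Finset V) :
    (R.filter fun z => σ u * σ z = s) = R.filter fun z => σ z = σ u * s := by
  refine Finset.filter_congr fun z _ => ?_
  constructor
  · rintro rfl
    rw [← mul_assoc, Int.units_mul_self, one_mul]
  · intro h
    rw [h, ← mul_assoc, Int.units_mul_self, one_mul]

variable {σ} {lo hi : ℕ}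

/-- A vertex of `U` has at most `hi` partners outside `R` in each class, so each of the two factors
of `noEdgeProb` occurs at most `hi` times. -/
lemma pow_le_prod_outPairs (hhi : ∀ s, (Finset.univ.filter fun z => σ z = s).card ≤ hi)
    {U R : Finset V} (h : U ⊆ R) :
    noEdgeProb ρ ^ (hi * U.card) ≤ ∏ e ∈ outPairs U R, (1 - (pairProb σ ρ e : ℝ)) := by
  rw [prod_outPairs h (fun e => 1 - (pairProb σ ρ e : ℝ)), pow_mul, ← Finset.prod_const]
  refine Finset.prod_le_prod (fun _ _ => pow_nonneg (noEdgeProb_nonneg ρ) _) fun u _ => ?_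
  rw [prod_compl_eq, noEdgeProb, ← Finset.prod_pow]
  refine Finset.prod_le_prod (fun s _ => pow_nonneg (sub_nonneg.2 (ρ s).2.2) _) fun s _ => ?_
  refine pow_le_pow_of_le_one (sub_nonneg.2 (ρ s).2.2) (sub_le_self _ (ρ s).2.1) ?_
  rw [filter_mul_eq]
  exact (Finset.card_le_card (Finset.filter_subset_filter _ (Finset.subset_univ _))).trans (hhi _)

lemma prod_outPairs_le (hlo : ∀ s, lo ≤ (Finset.univ.filter fun z => σ z = s).card)
    {U R : Finset V} (h : U ⊆ R) :
    ∏ e ∈ outPairs U R, (1 - (pairProb σ ρ e : ℝ)) ≤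
      noEdgeProb ρ ^ ((lo - R.card) * U.card) := by
  rw [prod_outPairs h (fun e => 1 - (pairProb σ ρ e : ℝ)), pow_mul, ← Finset.prod_const]
  refine Finset.prod_le_prod (fun u _ => Finset.prod_nonneg fun z _ =>
    sub_nonneg.2 (pairProb σ ρ _).2.2) fun u _ => ?_
  rw [prod_compl_eq, noEdgeProb, ← Finset.prod_pow]
  refine Finset.prod_le_prod (fun s _ => pow_nonneg (sub_nonneg.2 (ρ s).2.2) _) fun s _ => ?_
  refine pow_le_pow_of_le_one (sub_nonneg.2 (ρ s).2.2) (sub_le_self _ (ρ s).2.1) ?_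
  rw [filter_mul_eq, Nat.sub_le_iff_le_add]
  refine (hlo (σ u * s)).trans ?_
  have : (Finset.univ.filter fun z => σ z = σ u * s) ⊆
      (Rᶜ.filter fun z => σ z = σ u * s) ∪ R := by
    intro z hz
    by_cases hzR : z ∈ R
    · exact Finset.mem_union_right _ hzR
    · exact Finset.mem_union_left _ (Finset.mem_filter.2
        ⟨Finset.mem_compl.2 hzR, (Finset.mem_filter.1 hz).2⟩)
  exact (Finset.card_le_card this).trans (Finset.card_union_le _ _)

end OutPairs

end PlantedBisection

/-! ### The probability that given maps are copies -/

namespace RootedLabelledGraph.ParentMap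

open PlantedBisection

variable {W V : Type*} [Fintype W] [DecidableEq W] [Fintype V] [DecidableEq V]
  {X : RootedLabelledGraph W} {t : ℕ} (P : X.ParentMap t)

/-- The images of the edges of `X`. -/
def treeEdges (φ : W → V) : Finset (Sym2 V) :=
  (Finset.univ.erase X.root).image fun w => s(φ w, φ (P.parent w))

/-- The images of the vertices at depth less than `t`. -/
def innerImage (φ : W → V) : Finset V := (Finset.univ.filter fun u => P.depth u < t).image φ

variable {P} {φ φ' : W → V} {b : Sym2 V → Prop} {σ : V → ℤˣ}

lemma treeEdges_subset : P.treeEdges φ ⊆ (Finset.univ.image φ).sym2 := by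
  intro e he
  obtain ⟨w, -, rfl⟩ := Finset.mem_image.1 he
  simp

lemma innerImage_subset : P.innerImage φ ⊆ Finset.univ.image φ :=
  Finset.image_subset_image (Finset.filter_subset _ _)

lemma card_innerImage (hφ : Function.Injective φ) : (P.innerImage φ).card = P.numInner :=
  Finset.card_image_of_injective _ hφ

lemma prod_treeEdges (hφ : Function.Injective φ) (hσ : ∀ w, σ (φ w) = X.label w)
    (ρ : ℤˣ → unitInterval) : ∏ e ∈ P.treeEdges φ, (pairProb σ ρ e : ℝ) =
      ∏ w ∈ Finset.univ.erase X.root, (ρ (P.rel w) : ℝ) := by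
  rw [treeEdges, Finset.prod_image]
  · refine Finset.prod_congr rfl fun w _ => ?_
    rw [pairProb_mk, hσ, hσ, rel]
  · intro w hw w' hw' h
    have hw := P.depth_parent w (Finset.mem_erase.1 (Finset.mem_coe.1 hw)).1
    have hw' := P.depth_parent w' (Finset.mem_erase.1 (Finset.mem_coe.1 hw')).1
    rcases Sym2.eq_iff.1 h with h | h
    · exact hφ h.1
    · have h1 := hφ h.1
      have h2 := hφ h.2
      rw [← h1] at hw'
      rw [h2] at hw
      omega

lemma IsCopy.treeEdges_present (h : P.IsCopy (graphOf b) σ φ) : ∀ e ∈ P.treeEdges φ, b e := by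
  intro e he
  obtain ⟨w, hw, rfl⟩ := Finset.mem_image.1 he
  have := (h.adj_iff _ _).2 (P.adj_parent (Finset.mem_erase.1 hw).1).symm
  exact (graphOf_adj.1 this).1

lemma IsCopy.not_mem_range (h : P.IsCopy (graphOf b) σ φ) {u z : V} (hu : u ∈ P.innerImage φ)
    (hz : z ∉ Finset.univ.image φ) : ¬ b s(u, z) := by
  intro hb
  obtain ⟨u, hu', rfl⟩ := Finset.mem_image.1 hu
  have hne : φ u ≠ z := by
    rintro rfl
    simp at hz
  obtain ⟨w, rfl⟩ := h.closed u (Finset.mem_filter.1 hu').2 z (graphOf_adj.2 ⟨hb, hne⟩)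
  simp at hz

/-- More pairs are required to be absent than necessary, including the diagonal ones. Within the
image this is a bounded number of pairs, so it does not affect the limit. -/
lemma isCopy_of_present_absent (hφ : Function.Injective φ) (hσ : ∀ w, σ (φ w) = X.label w)
    (h1 : ∀ e ∈ P.treeEdges φ, b e)
    (h2 : ∀ e ∈ outPairs (P.innerImage φ) (Finset.univ.image φ) ∪
      ((Finset.univ.image φ).sym2 \ P.treeEdges φ), ¬ b e) : P.IsCopy (graphOf b) σ φ := by
  refine ⟨hφ, hσ, fun u w => ?_, fun u hu z hz => ?_⟩
  · rw [graphOf_adj]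
    constructor
    · rintro ⟨hb, -⟩
      have hmem : s(φ u, φ w) ∈ P.treeEdges φ := by
        by_contra hn
        refine h2 _ (Finset.mem_union_right _ (Finset.mem_sdiff.2 ⟨?_, hn⟩)) hb
        simp
      obtain ⟨x, hx, hxe⟩ := Finset.mem_image.1 hmem
      have hx := P.adj_parent (Finset.mem_erase.1 hx).1
      rcases Sym2.eq_iff.1 hxe with h | h
      · rw [← hφ h.1, ← hφ h.2]
        exact hx.symm
      · rw [← hφ h.1, ← hφ h.2]
        exact hx
    · intro h
      refine ⟨?_, fun hne => h.ne (hφ hne)⟩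
      rcases (P.adj_iff u w).1 h with ⟨hw, rfl⟩ | ⟨hu, rfl⟩
      · rw [Sym2.eq_swap]
        exact h1 _ (Finset.mem_image_of_mem _ (Finset.mem_erase.2 ⟨hw, Finset.mem_univ _⟩))
      · exact h1 _ (Finset.mem_image_of_mem (fun w => s(φ w, φ (P.parent w)))
          (Finset.mem_erase.2 ⟨hu, Finset.mem_univ _⟩))
  · by_contra hn
    refine h2 s(φ u, z) (Finset.mem_union_left _ (Finset.mem_image.2 ⟨(φ u, z), ?_, rfl⟩))
      (graphOf_adj.1 hz).1
    refine Finset.mem_product.2 ⟨Finset.mem_image_of_mem _ (by simpa using hu), ?_⟩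
    simpa using hn

variable {lo hi : ℕ} (ρ : ℤˣ → unitInterval)

variable (P) in
/-- The probability that given vertices are joined as in `X`. -/
noncomputable def edgesProb : ℝ := ∏ w ∈ Finset.univ.erase X.root, (ρ (P.rel w) : ℝ)

variable (P) in
lemma edgesProb_nonneg : 0 ≤ P.edgesProb ρ := Finset.prod_nonneg fun _ _ => (ρ _).2.1

/-- The binomial term in the exponent is the number of all pairs inside the image, each charged one
full factor `noEdgeProb`. -/
lemma le_edgeMeasure_isCopy (hhi : ∀ s, (Finset.univ.filter fun z => σ z = s).card ≤ hi)
    (hφ : Function.Injective φ) (hσ : ∀ w, σ (φ w) = X.label w) :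
    P.edgesProb ρ * noEdgeProb ρ ^ (hi * P.numInner + (Fintype.card W + 1).choose 2) ≤
      (edgeMeasure (pairProb σ ρ)).real {b | P.IsCopy (graphOf b) σ φ} := by
  set R := Finset.univ.image φ with hR
  set U := P.innerImage φ with hU
  set E := P.treeEdges φ with hE
  have hdisj : Disjoint E (outPairs U R ∪ (R.sym2 \ E)) := by
    rw [Finset.disjoint_union_right]
    exact ⟨(disjoint_sym2_outPairs U R).mono_left treeEdges_subset, Finset.disjoint_sdiff⟩
  calc _ = (∏ e ∈ E, (pairProb σ ρ e : ℝ)) *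
        (noEdgeProb ρ ^ (hi * U.card) * noEdgeProb ρ ^ R.sym2.card) := by
        rw [prod_treeEdges hφ hσ, card_innerImage hφ, Finset.card_sym2, hR,
          Finset.card_image_of_injective _ hφ, Finset.card_univ, pow_add, edgesProb]
    _ ≤ (∏ e ∈ E, (pairProb σ ρ e : ℝ)) *
        ((∏ e ∈ outPairs U R, (1 - (pairProb σ ρ e : ℝ))) *
          ∏ e ∈ R.sym2 \ E, (1 - (pairProb σ ρ e : ℝ))) := by
        refine mul_le_mul_of_nonneg_left ?_ (Finset.prod_nonneg fun e _ => (pairProb σ ρ e).2.1)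
        refine mul_le_mul (pow_le_prod_outPairs ρ hhi innerImage_subset) ?_
          (pow_nonneg (noEdgeProb_nonneg ρ) _)
          (Finset.prod_nonneg fun e _ => sub_nonneg.2 (pairProb σ ρ e).2.2)
        calc noEdgeProb ρ ^ R.sym2.card ≤ noEdgeProb ρ ^ (R.sym2 \ E).card :=
              pow_le_pow_of_le_one (noEdgeProb_nonneg ρ) (noEdgeProb_le_one ρ)
                (Finset.card_le_card Finset.sdiff_subset)
          _ ≤ _ := by
              rw [← Finset.prod_const]
              exact Finset.prod_le_prod (fun _ _ => noEdgeProb_nonneg ρ)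
                fun e _ => noEdgeProb_le ρ _
    _ = (∏ e ∈ E, (pairProb σ ρ e : ℝ)) *
        ∏ e ∈ outPairs U R ∪ (R.sym2 \ E), (1 - (pairProb σ ρ e : ℝ)) := by
        rw [Finset.prod_union]
        exact ((disjoint_sym2_outPairs U R).mono_left Finset.sdiff_subset).symm
    _ = (edgeMeasure (pairProb σ ρ)).real {b | (∀ e ∈ E, b e) ∧
        ∀ e ∈ outPairs U R ∪ (R.sym2 \ E), ¬ b e} :=
        (edgeMeasure_real_present_absent _ hdisj).symm
    _ ≤ _ := measureReal_mono (fun b hb => isCopy_of_present_absent hφ hσ hb.1 hb.2)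
        (measure_ne_top _ _)

/-- For an upper bound it suffices to keep the tree edges and the absence of edges from inner
vertices to the outside of both images. These concern disjoint sets of pairs; absences inside the
union are dropped. -/
lemma edgeMeasure_isCopy_isCopy_le
    (hlo : ∀ s, lo ≤ (Finset.univ.filter fun z => σ z = s).card)
    (hdisj : Disjoint (Finset.univ.image φ) (Finset.univ.image φ')) :
    (edgeMeasure (pairProb σ ρ)).real
      {b | P.IsCopy (graphOf b) σ φ ∧ P.IsCopy (graphOf b) σ φ'} ≤
    P.edgesProb ρ ^ 2 *
      noEdgeProb ρ ^ ((lo - 2 * Fintype.card W) * (2 * P.numInner)) := by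
  -- A single outcome in the event supplies injectivity and label preservation of both maps; an
  -- empty event is trivial.
  by_cases hcopy : ∃ b, P.IsCopy (graphOf b) σ φ ∧ P.IsCopy (graphOf b) σ φ'
  swap
  · have : {b | P.IsCopy (graphOf b) σ φ ∧ P.IsCopy (graphOf b) σ φ'} = ∅ :=
      Set.eq_empty_of_forall_notMem fun b hb => hcopy ⟨b, hb⟩
    rw [this, measureReal_empty]
    exact mul_nonneg (sq_nonneg _) (pow_nonneg (noEdgeProb_nonneg ρ) _)
  obtain ⟨b₀, hb, hb'⟩ := hcopy
  set R := Finset.univ.image φ ∪ Finset.univ.image φ' with hR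
  set U := P.innerImage φ ∪ P.innerImage φ' with hU
  have hUR : U ⊆ R := Finset.union_subset_union innerImage_subset innerImage_subset
  have hUc : U.card = 2 * P.numInner := by
    rw [hU, Finset.card_union_of_disjoint (hdisj.mono innerImage_subset innerImage_subset),
      card_innerImage hb.injective, card_innerImage hb'.injective]
    ring
  have hRc : R.card = 2 * Fintype.card W := by
    rw [hR, Finset.card_union_of_disjoint hdisj, Finset.card_image_of_injective _ hb.injective,
      Finset.card_image_of_injective _ hb'.injective, Finset.card_univ]
    ring
  have hEE : Disjoint (P.treeEdges φ) (P.treeEdges φ') := by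
    rw [Finset.disjoint_left]
    intro e he he'
    induction e using Sym2.ind with
    | _ x y =>
      exact Finset.disjoint_left.1 hdisj (Finset.mk_mem_sym2_iff.1 (treeEdges_subset he)).1
        (Finset.mk_mem_sym2_iff.1 (treeEdges_subset he')).1
  have hEF : Disjoint (P.treeEdges φ ∪ P.treeEdges φ') (outPairs U R) :=
    (disjoint_sym2_outPairs U R).mono_left (Finset.union_subset
      (treeEdges_subset.trans (Finset.sym2_mono Finset.subset_union_left))
      (treeEdges_subset.trans (Finset.sym2_mono Finset.subset_union_right)))
  calc _ ≤ (edgeMeasure (pairProb σ ρ)).real {b | (∀ e ∈ P.treeEdges φ ∪ P.treeEdges φ', b e) ∧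
        ∀ e ∈ outPairs U R, ¬ b e} := by
        refine measureReal_mono ?_ (measure_ne_top _ _)
        rintro b ⟨hc, hc'⟩
        refine ⟨fun e he => ?_, fun e he => ?_⟩
        · rcases Finset.mem_union.1 he with he | he
          · exact hc.treeEdges_present e he
          · exact hc'.treeEdges_present e he
        · obtain ⟨⟨u, z⟩, huz, rfl⟩ := Finset.mem_image.1 he
          obtain ⟨hu, hz⟩ := Finset.mem_product.1 huz
          rw [Finset.mem_compl, Finset.notMem_union] at hz
          rcases Finset.mem_union.1 hu with hu | hu
          · exact hc.not_mem_range hu hz.1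
          · exact hc'.not_mem_range hu hz.2
    _ = P.edgesProb ρ ^ 2 * ∏ e ∈ outPairs U R, (1 - (pairProb σ ρ e : ℝ)) := by
        rw [edgeMeasure_real_present_absent _ hEF, Finset.prod_union hEE,
          prod_treeEdges hb.injective hb.label, prod_treeEdges hb'.injective hb'.label, edgesProb,
          sq]
    _ ≤ _ := by
        rw [← hRc, ← hUc]
        exact mul_le_mul_of_nonneg_left (prod_outPairs_le ρ hlo hUR) (sq_nonneg _)

end RootedLabelledGraph.ParentMap

/-! ### First and second moments of the number of copies -/

namespace RootedLabelledGraph.ParentMap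

open PlantedBisection

section Copies

variable {W V : Type*} [Fintype W] [DecidableEq W] [Fintype V] [DecidableEq V]
  {X : RootedLabelledGraph W} {t : ℕ} (P : X.ParentMap t)

open Classical in
/-- The copies of `X` in a labelled graph. -/
noncomputable def copies (G : SimpleGraph V) (σ : V → ℤˣ) : Finset (W → V) :=
  Finset.univ.filter fun φ => P.IsCopy G σ φ

lemma mem_copies {G : SimpleGraph V} {σ : V → ℤˣ} {φ : W → V} :
    φ ∈ P.copies G σ ↔ P.IsCopy G σ φ := by
  simp [copies]

/-- The copies are sorted by the image of the root; each fibre has `|Aut X|` elements or none. -/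
lemma card_copies_eq (G : SimpleGraph V) (σ : V → ℤˣ) :
    (P.copies G σ).card = Nat.card (Isos X X) *
      {v | ((RootedLabelledGraph.mk G v σ).nbhd t).Isom X}.ncard := by
  classical
  rw [Finset.card_eq_sum_card_fiberwise (f := fun φ => φ X.root) (t := Finset.univ)
    fun _ _ => Finset.mem_coe.2 (Finset.mem_univ _)]
  have h1 : ∀ v, ((P.copies G σ).filter fun φ => φ X.root = v).card =
      if ((RootedLabelledGraph.mk G v σ).nbhd t).Isom X then Nat.card (Isos X X) else 0 := by
    intro v
    rw [← P.card_copies, Nat.card_eq_fintype_card, Fintype.card_subtype, copies,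
      Finset.filter_filter]
  simp_rw [h1]
  rw [Finset.sum_ite, Finset.sum_const, Finset.sum_const_zero, add_zero, smul_eq_mul, mul_comm,
    Set.ncard_eq_toFinset_card']
  congr 2
  ext v
  simp

variable {P} in
lemma IsCopy.preconnected_induce {G : SimpleGraph V} {σ : V → ℤˣ} {φ : W → V}
    (h : P.IsCopy G σ φ) : (G.induce (Set.range φ)).Preconnected := by
  have key : ∀ w, (G.induce (Set.range φ)).Reachable ⟨φ X.root, Set.mem_range_self _⟩
      ⟨φ w, Set.mem_range_self _⟩ := by
    refine P.depth_induction ?_ ?_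
    · exact SimpleGraph.Reachable.refl _
    · intro w hw ih
      refine ih.trans (SimpleGraph.Adj.reachable ?_)
      exact (h.adj_iff _ _).2 (P.adj_parent hw)
  rintro ⟨_, u, rfl⟩ ⟨_, w, rfl⟩
  exact (key u).symm.trans (key w)

variable {P} in
lemma IsCopy.union_mem_denseSets {G : SimpleGraph V} {σ : V → ℤˣ} {φ φ' : W → V}
    (h : P.IsCopy G σ φ) (h' : P.IsCopy G σ φ')
    (hne : ¬ Disjoint (Finset.univ.image φ) (Finset.univ.image φ')) :
    Finset.univ.image φ ∪ Finset.univ.image φ' ∈ denseSets G (2 * Fintype.card W) 0 := by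
  have hset : ((Finset.univ.image φ ∪ Finset.univ.image φ' : Finset V) : Set V) =
      Set.range φ ∪ Set.range φ' := by simp
  have hconn : (G.induce ((Finset.univ.image φ ∪ Finset.univ.image φ' : Finset V) :
      Set V)).Connected := by
    rw [hset]
    refine SimpleGraph.induce_union_connected h.preconnected_induce h'.preconnected_induce ?_
    obtain ⟨z, hz, hz'⟩ := Finset.not_disjoint_iff.1 hne
    exact ⟨z, by simpa using hz, by simpa using hz'⟩
  refine mem_denseSets.2 ⟨?_, ?_, ?_⟩
  · exact ⟨φ X.root, Finset.mem_union_left _ (Finset.mem_image_of_mem _ (Finset.mem_univ _))⟩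
  · refine (Finset.card_union_le _ _).trans ?_
    have h1 : (Finset.univ.image φ).card ≤ Fintype.card W := Finset.card_image_le
    have h2 : (Finset.univ.image φ').card ≤ Fintype.card W := Finset.card_image_le
    omega
  · exact hconn.spansEdges

/-- Pairs of copies that share a vertex are counted by the connected sets which they cover. -/
lemma card_copies_sq_le (G : SimpleGraph V) (σ : V → ℤˣ) :
    (P.copies G σ).card ^ 2 ≤
      (((P.copies G σ) ×ˢ (P.copies G σ)).filter fun a =>
        Disjoint (Finset.univ.image a.1) (Finset.univ.image a.2)).card +
      ((2 * Fintype.card W) ^ Fintype.card W) ^ 2 *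
        (denseSets G (2 * Fintype.card W) 0).card := by
  classical
  rw [sq, ← Finset.card_product, ← Finset.card_filter_add_card_filter_not (fun a : (W → V) × (W → V) =>
    Disjoint (Finset.univ.image a.1) (Finset.univ.image a.2))]
  refine Nat.add_le_add_left ?_ _
  refine Finset.card_le_mul_card_image_of_maps_to
    (f := fun a : (W → V) × (W → V) => Finset.univ.image a.1 ∪ Finset.univ.image a.2) ?_ _ ?_
  · intro a ha
    obtain ⟨ha, hd⟩ := Finset.mem_filter.1 ha
    obtain ⟨h1, h2⟩ := Finset.mem_product.1 ha
    exact IsCopy.union_mem_denseSets ((P.mem_copies).1 h1) ((P.mem_copies).1 h2) hd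
  · intro S hS
    have hSc : S.card ≤ 2 * Fintype.card W := (mem_denseSets.1 hS).2.1
    -- Two copies with union `S` are two maps from `W` into `S`, so a fibre is bounded independently
    -- of `n`.
    refine (Finset.card_le_card (t := (Fintype.piFinset fun _ : W => S) ×ˢ
      (Fintype.piFinset fun _ : W => S)) ?_).trans ?_
    · intro a ha
      have h := (Finset.mem_filter.1 ha).2
      rw [Finset.mem_product, Fintype.mem_piFinset, Fintype.mem_piFinset]
      rw [← h]
      exact ⟨fun w => by simp, fun w => by simp⟩
    · rw [Finset.card_product, Fintype.card_piFinset, Finset.prod_const, Finset.card_univ, ← sq]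
      gcongr

variable (X) in
/-- The injective maps which preserve the labels. -/
noncomputable def labelledInjections (σ : V → ℤˣ) : Finset (W → V) :=
  Finset.univ.filter fun φ => Function.Injective φ ∧ ∀ w, σ (φ w) = X.label w

variable {σ : V → ℤˣ} {lo hi : ℕ}

lemma card_labelled_le (hhi : ∀ s, (Finset.univ.filter fun z => σ z = s).card ≤ hi) :
    (Finset.univ.filter fun φ : W → V => ∀ w, σ (φ w) = X.label w).card ≤ hi ^ Fintype.card W := by
  have : (Finset.univ.filter fun φ : W → V => ∀ w, σ (φ w) = X.label w) =
      Fintype.piFinset fun w => Finset.univ.filter fun z => σ z = X.label w := by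
    ext φ
    simp
  rw [this, Fintype.card_piFinset, Fintype.card]
  exact Finset.prod_le_pow_card _ _ _ fun w _ => hhi _

/-- Embeddings chosen separately for each label combine to an injection, since vertices with
different labels have images in different classes. -/
lemma le_card_labelledInjections
    (hlo : ∀ s, lo ≤ (Finset.univ.filter fun z => σ z = s).card) :
    (lo - Fintype.card W) ^ Fintype.card W ≤ (labelledInjections X σ).card := by
  let F : (∀ s : ℤˣ, {w // X.label w = s} ↪ {z // σ z = s}) → labelledInjections X σ := fun f =>
    ⟨fun w => (f (X.label w) ⟨w, rfl⟩ : V), by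
      have hlab : ∀ w, σ (f (X.label w) ⟨w, rfl⟩ : V) = X.label w := fun w => (f _ _).2
      refine Finset.mem_filter.2 ⟨Finset.mem_univ _, fun u w h => ?_, hlab⟩
      have huw : X.label u = X.label w := by
        rw [← hlab u, ← hlab w]
        exact congrArg σ h
      have key : ∀ (s : ℤˣ) (hs : X.label u = s) (hs' : X.label w = s),
          (f (X.label u) ⟨u, rfl⟩ : V) = f s ⟨u, hs⟩ ∧ (f (X.label w) ⟨w, rfl⟩ : V) = f s ⟨w, hs'⟩ := by
        rintro s rfl hs'
        refine ⟨rfl, ?_⟩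
        have : ∀ (s' : ℤˣ) (h1 : X.label w = s'), (f (X.label w) ⟨w, rfl⟩ : V) = f s' ⟨w, h1⟩ := by
          rintro s' rfl
          rfl
        exact this _ hs'
      obtain ⟨h1, h2⟩ := key (X.label w) huw rfl
      simp only [h1] at h
      exact congrArg Subtype.val ((f (X.label w)).injective (Subtype.ext h))⟩
  have hF : Function.Injective F := by
    intro f g hfg
    funext s
    ext ⟨w, rfl⟩
    exact congrFun (congrArg Subtype.val hfg) w
  have h1 := Fintype.card_le_of_injective F hF
  rw [Fintype.card_coe, Fintype.card_pi] at h1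
  refine le_trans ?_ h1
  have hsum : ∑ s : ℤˣ, Fintype.card {w // X.label w = s} = Fintype.card W := by
    simp_rw [Fintype.card_subtype]
    exact (Finset.card_eq_sum_card_fiberwise (f := X.label) (t := Finset.univ)
      fun _ _ => Finset.mem_coe.2 (Finset.mem_univ _)).symm
  calc (lo - Fintype.card W) ^ Fintype.card W =
        ∏ s : ℤˣ, (lo - Fintype.card W) ^ Fintype.card {w // X.label w = s} := by
        rw [Finset.prod_pow_eq_pow_sum, hsum]
    _ ≤ _ := by
        refine Finset.prod_le_prod' fun s _ => ?_
        rw [Fintype.card_embedding_eq]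
        refine le_trans ?_ (Nat.pow_sub_le_descFactorial _ _)
        refine Nat.pow_le_pow_left ?_ _
        have h2 : Fintype.card {w // X.label w = s} ≤ Fintype.card W := Fintype.card_subtype_le _
        have h3 := hlo s
        rw [← Fintype.card_subtype] at h3
        omega

variable (ρ : ℤˣ → unitInterval)

lemma le_integral_card_copies
    (hlo : ∀ s, lo ≤ (Finset.univ.filter fun z => σ z = s).card)
    (hhi : ∀ s, (Finset.univ.filter fun z => σ z = s).card ≤ hi) :
    ((lo - Fintype.card W : ℕ) : ℝ) ^ Fintype.card W * (P.edgesProb ρ *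
        noEdgeProb ρ ^ (hi * P.numInner + (Fintype.card W + 1).choose 2)) ≤
      ∫ b, ((P.copies (graphOf b) σ).card : ℝ) ∂edgeMeasure (pairProb σ ρ) := by
  simp_rw [copies]
  rw [integral_card_filter]
  calc _ ≤ ((labelledInjections X σ).card : ℝ) * (P.edgesProb ρ *
        noEdgeProb ρ ^ (hi * P.numInner + (Fintype.card W + 1).choose 2)) := by
        refine mul_le_mul_of_nonneg_right ?_ (mul_nonneg (P.edgesProb_nonneg ρ)
          (pow_nonneg (noEdgeProb_nonneg ρ) _))
        exact_mod_cast le_card_labelledInjections hlo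
    _ = ∑ φ ∈ labelledInjections X σ, (P.edgesProb ρ *
        noEdgeProb ρ ^ (hi * P.numInner + (Fintype.card W + 1).choose 2)) := by
        rw [Finset.sum_const, nsmul_eq_mul]
    _ ≤ ∑ φ ∈ labelledInjections X σ,
        (edgeMeasure (pairProb σ ρ)).real {b | P.IsCopy (graphOf b) σ φ} := by
        refine Finset.sum_le_sum fun φ hφ => ?_
        obtain ⟨h1, h2⟩ := (Finset.mem_filter.1 hφ).2
        exact le_edgeMeasure_isCopy ρ hhi h1 h2
    _ ≤ _ := Finset.sum_le_sum_of_subset_of_nonneg (Finset.subset_univ _)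
        fun _ _ _ => measureReal_nonneg

lemma integral_card_copies_sq_le
    (hlo : ∀ s, lo ≤ (Finset.univ.filter fun z => σ z = s).card)
    (hhi : ∀ s, (Finset.univ.filter fun z => σ z = s).card ≤ hi) {D : ℝ} (hD : 1 ≤ D)
    (hp : ∀ s, (ρ s : ℝ) ≤ D / Fintype.card V) :
    ∫ b, ((P.copies (graphOf b) σ).card : ℝ) ^ 2 ∂edgeMeasure (pairProb σ ρ) ≤
      ((hi : ℝ) ^ Fintype.card W * P.edgesProb ρ) ^ 2 *
        noEdgeProb ρ ^ ((lo - 2 * Fintype.card W) * (2 * P.numInner)) +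
      (((2 * Fintype.card W : ℕ) : ℝ) ^ Fintype.card W) ^ 2 *
        (((2 * Fintype.card W : ℕ) : ℝ) * 2 ^ (2 * Fintype.card W + 1).choose 2 *
          D ^ (2 * Fintype.card W) * Fintype.card V) := by
  classical
  set L := Finset.univ.filter fun φ : W → V => ∀ w, σ (φ w) = X.label w with hL
  set M := (L ×ˢ L).filter fun a : (W → V) × (W → V) =>
    Disjoint (Finset.univ.image a.1) (Finset.univ.image a.2) with hM
  have hdense := integral_card_denseSets_le (pairProb σ ρ) hD (fun e => hp _)
    (2 * Fintype.card W) 0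
  rw [pow_zero, one_mul, add_zero] at hdense
  have hpt : ∀ b : Sym2 V → Prop, ((P.copies (graphOf b) σ).card : ℝ) ^ 2 ≤
      ((M.filter fun a => P.IsCopy (graphOf b) σ a.1 ∧ P.IsCopy (graphOf b) σ a.2).card : ℝ) +
      (((2 * Fintype.card W : ℕ) : ℝ) ^ Fintype.card W) ^ 2 *
        ((denseSets (graphOf b) (2 * Fintype.card W) 0).card : ℝ) := by
    intro b
    have h1 := P.card_copies_sq_le (graphOf b) σ
    have h2 : ((P.copies (graphOf b) σ) ×ˢ (P.copies (graphOf b) σ)).filter (fun a =>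
        Disjoint (Finset.univ.image a.1) (Finset.univ.image a.2)) ⊆
        M.filter fun a => P.IsCopy (graphOf b) σ a.1 ∧ P.IsCopy (graphOf b) σ a.2 := by
      intro a ha
      obtain ⟨ha, hd⟩ := Finset.mem_filter.1 ha
      obtain ⟨ha1, ha2⟩ := Finset.mem_product.1 ha
      rw [mem_copies] at ha1 ha2
      exact Finset.mem_filter.2 ⟨Finset.mem_filter.2 ⟨Finset.mem_product.2
        ⟨Finset.mem_filter.2 ⟨Finset.mem_univ _, ha1.label⟩,
          Finset.mem_filter.2 ⟨Finset.mem_univ _, ha2.label⟩⟩, hd⟩, ha1, ha2⟩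
    have h3 := h1.trans (Nat.add_le_add_right (Finset.card_le_card h2) _)
    exact_mod_cast h3
  refine (integral_mono Integrable.of_finite Integrable.of_finite hpt).trans ?_
  rw [integral_add Integrable.of_finite Integrable.of_finite, integral_const_mul]
  refine add_le_add ?_ (mul_le_mul_of_nonneg_left hdense (by positivity))
  rw [integral_card_filter]
  calc _ ≤ ∑ a ∈ M, P.edgesProb ρ ^ 2 *
        noEdgeProb ρ ^ ((lo - 2 * Fintype.card W) * (2 * P.numInner)) :=
        Finset.sum_le_sum fun a ha =>
          edgeMeasure_isCopy_isCopy_le ρ hlo (Finset.mem_filter.1 ha).2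
    _ = M.card * (P.edgesProb ρ ^ 2 *
        noEdgeProb ρ ^ ((lo - 2 * Fintype.card W) * (2 * P.numInner))) := by
        rw [Finset.sum_const, nsmul_eq_mul]
    _ ≤ ((hi : ℝ) ^ Fintype.card W) ^ 2 * (P.edgesProb ρ ^ 2 *
        noEdgeProb ρ ^ ((lo - 2 * Fintype.card W) * (2 * P.numInner))) := by
        refine mul_le_mul_of_nonneg_right ?_ (mul_nonneg (sq_nonneg _)
          (pow_nonneg (noEdgeProb_nonneg ρ) _))
        have h1 : M.card ≤ (hi ^ Fintype.card W) ^ 2 := by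
          refine (Finset.card_filter_le _ _).trans ?_
          rw [Finset.card_product, ← sq]
          exact Nat.pow_le_pow_left (card_labelled_le hhi) 2
        exact_mod_cast h1
    _ = _ := by ring

end Copies

end RootedLabelledGraph.ParentMap

/-! ### Asymptotics of the moment bounds -/

namespace PlantedBisection

/-- The edge probabilities of the planted bisection model by the product of the labels. -/
noncomputable def bisectionProb (n : ℕ) (dPos dNeg : ℝ≥0) (s : ℤˣ) : unitInterval :=
  edgeProb n (if s = 1 then dPos else dNeg)

lemma tendsto_natCast_mul_edgeProb (d : ℝ≥0) :
    Tendsto (fun n : ℕ => (n : ℝ) * (edgeProb n d : ℝ)) atTop (𝓝 (2 * d)) := by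
  refine tendsto_const_nhds.congr' ?_
  filter_upwards [eventually_ge_atTop (max 1 ⌈2 * (d : ℝ)⌉₊)] with n hn
  have h1 : (1 : ℝ) ≤ n := by exact_mod_cast (le_max_left _ _).trans hn
  have h2 : 2 * (d : ℝ) ≤ n := Nat.ceil_le.1 ((le_max_right _ _).trans hn)
  have h3 : 2 * (d : ℝ) / n ≤ 1 := (div_le_one (by linarith)).2 h2
  change _ = (n : ℝ) * min 1 (2 * (d : ℝ) / n)
  rw [min_eq_right h3]
  field_simp

lemma edgeProb_le (n : ℕ) {d d' : ℝ≥0} (h : d ≤ d') :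
    (edgeProb n d : ℝ) ≤ (2 * d' + 1 : ℝ) / n := by
  refine (min_le_right _ _).trans ?_
  have : (d : ℝ) ≤ d' := h
  gcongr
  linarith

lemma tendsto_noEdgeProb_pow_self (dPos dNeg : ℝ≥0) :
    Tendsto (fun n : ℕ => noEdgeProb (bisectionProb n dPos dNeg) ^ n) atTop
      (𝓝 (Real.exp (-((dPos : ℝ) + dNeg)) ^ 2)) := by
  have key : ∀ d : ℝ≥0, Tendsto (fun n : ℕ => (1 - (edgeProb n d : ℝ)) ^ n) atTop
      (𝓝 (Real.exp (-(2 * (d : ℝ))))) := by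
    intro d
    have := Real.tendsto_one_add_pow_exp_of_tendsto (g := fun n => -(edgeProb n d : ℝ))
      (t := -(2 * (d : ℝ))) (by simpa using (tendsto_natCast_mul_edgeProb d).neg)
    simpa [sub_eq_add_neg] using this
  have h := (key dPos).mul (key dNeg)
  rw [← Real.exp_add] at h
  rw [← Real.exp_nat_mul]
  convert h using 2 with n
  · rw [noEdgeProb, show (Finset.univ : Finset ℤˣ) = {1, -1} from rfl,
      Finset.prod_pair (by decide), mul_pow, bisectionProb, bisectionProb, if_pos rfl,
      if_neg (by decide)]
  · congr 1
    push_cast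
    ring

/-- The power is rewritten as `(noEdgeProb ^ n) ^ (a n / n)`; the limit of the base is positive, so
real powers are continuous there. -/
lemma tendsto_noEdgeProb_pow (dPos dNeg : ℝ≥0) {a : ℕ → ℕ} {L : ℝ}
    (ha : Tendsto (fun n => (a n : ℝ) / n) atTop (𝓝 L)) :
    Tendsto (fun n : ℕ => noEdgeProb (bisectionProb n dPos dNeg) ^ a n) atTop
      (𝓝 ((Real.exp (-((dPos : ℝ) + dNeg)) ^ 2) ^ L)) := by
  refine ((tendsto_noEdgeProb_pow_self dPos dNeg).rpow ha (Or.inl (by positivity))).congr' ?_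
  filter_upwards [eventually_ge_atTop 1] with n hn
  have h1 : (n : ℝ) ≠ 0 := by positivity
  rw [← Real.rpow_natCast, ← Real.rpow_mul (noEdgeProb_nonneg _), mul_div_cancel₀ _ h1,
    Real.rpow_natCast]

/-- The constant `C` absorbs rounding and truncated subtraction in the bounds for the class sizes.
-/
lemma tendsto_div_half {f : ℕ → ℕ} (C : ℕ) (h1 : ∀ n, n ≤ 2 * f n + C)
    (h2 : ∀ n, 2 * f n ≤ n + C) : Tendsto (fun n => (f n : ℝ) / n) atTop (𝓝 (1 / 2)) := by
  have hC : Tendsto (fun n : ℕ => (C : ℝ) / 2 / n) atTop (𝓝 0) :=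
    tendsto_const_div_atTop_nhds_zero_nat _
  have hlo : Tendsto (fun n : ℕ => 1 / 2 - (C : ℝ) / 2 / n) atTop (𝓝 (1 / 2)) := by
    simpa only [sub_zero] using hC.const_sub (1 / 2)
  have hhi : Tendsto (fun n : ℕ => 1 / 2 + (C : ℝ) / 2 / n) atTop (𝓝 (1 / 2)) := by
    simpa only [add_zero] using hC.const_add (1 / 2)
  refine tendsto_of_tendsto_of_tendsto_of_le_of_le' hlo hhi ?_ ?_
  · filter_upwards [eventually_ge_atTop 1] with n hn
    have h3 : (0 : ℝ) < n := by positivity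
    have h4 : (n : ℝ) ≤ 2 * f n + C := by exact_mod_cast h1 n
    rw [sub_le_iff_le_add, ← add_div, le_div_iff₀ h3]
    linarith
  · filter_upwards [eventually_ge_atTop 1] with n hn
    have h3 : (0 : ℝ) < n := by positivity
    have h4 : 2 * (f n : ℝ) ≤ n + C := by exact_mod_cast h2 n
    have h5 : 1 / 2 + (C : ℝ) / 2 / n = (n / 2 + C / 2) / n := by field_simp
    rw [h5]
    gcongr
    linarith

end PlantedBisection

namespace RootedLabelledGraph.ParentMap

open PlantedBisection

variable {W : Type*} [Fintype W] [DecidableEq W]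
  {X : RootedLabelledGraph W} {t : ℕ} (P : X.ParentMap t) (dPos dNeg : ℝ≥0)

/-- There is one edge less than there are vertices: from `(n/2)^m` and `m - 1` factors `2d/n` one
factor `n/2` remains, whence the `1/2`. -/
lemma tendsto_pow_mul_edgesProb {f : ℕ → ℕ}
    (hf : Tendsto (fun n => (f n : ℝ) / n) atTop (𝓝 (1 / 2))) :
    Tendsto (fun n : ℕ => (f n : ℝ) ^ Fintype.card W *
      P.edgesProb (bisectionProb n dPos dNeg) / n) atTop
      (𝓝 (1 / 2 * ∏ w ∈ Finset.univ.erase X.root,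
        ((if P.rel w = 1 then dPos else dNeg : ℝ≥0) : ℝ))) := by
  have hcard : (Finset.univ.erase X.root).card + 1 = Fintype.card W := by
    rw [Finset.card_erase_of_mem (Finset.mem_univ _), Finset.card_univ]
    have := Fintype.card_pos_iff.2 ⟨X.root⟩
    omega
  have h1 : Tendsto (fun n : ℕ => ∏ w ∈ Finset.univ.erase X.root,
      (n : ℝ) * (bisectionProb n dPos dNeg (P.rel w) : ℝ)) atTop
      (𝓝 (∏ w ∈ Finset.univ.erase X.root,
        2 * ((if P.rel w = 1 then dPos else dNeg : ℝ≥0) : ℝ))) :=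
    tendsto_finsetProd _ fun w _ => tendsto_natCast_mul_edgeProb _
  have h2 := (hf.pow (Fintype.card W)).mul h1
  have h3 : (1 / 2 : ℝ) ^ Fintype.card W * ∏ w ∈ Finset.univ.erase X.root,
      2 * ((if P.rel w = 1 then dPos else dNeg : ℝ≥0) : ℝ) =
      1 / 2 * ∏ w ∈ Finset.univ.erase X.root,
        ((if P.rel w = 1 then dPos else dNeg : ℝ≥0) : ℝ) := by
    rw [Finset.prod_mul_distrib, Finset.prod_const, ← hcard, pow_succ]
    rw [show ∀ a b c d : ℝ, a * b * (c * d) = (a * c) * (b * d) by intros; ring, ← mul_pow]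
    norm_num
  rw [h3] at h2
  refine h2.congr' ?_
  filter_upwards [eventually_ge_atTop 1] with n hn
  have h4 : (n : ℝ) ≠ 0 := by positivity
  rw [Finset.prod_mul_distrib, Finset.prod_const, edgesProb, ← hcard, div_pow, pow_succ (n : ℝ)]
  field_simp

lemma copyDensity_eq : P.copyDensity dPos dNeg = 1 / 2 * (∏ w ∈ Finset.univ.erase X.root,
      ((if P.rel w = 1 then dPos else dNeg : ℝ≥0) : ℝ)) *
        (Real.exp (-((dPos : ℝ) + dNeg)) ^ 2) ^ ((P.numInner : ℝ) * (1 / 2)) := by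
  rw [copyDensity]
  congr 1
  rw [← Real.rpow_natCast _ 2, ← Real.rpow_mul (Real.exp_pos _).le, ← Real.rpow_natCast]
  congr 1
  push_cast
  ring

/-- The lower bound for the expected number of copies in the planted bisection graph on `n`
vertices. -/
noncomputable def meanLowerBound (n : ℕ) : ℝ :=
  ((n / 2 - Fintype.card W : ℕ) : ℝ) ^ Fintype.card W *
    (P.edgesProb (bisectionProb n dPos dNeg) * noEdgeProb (bisectionProb n dPos dNeg) ^
      ((n + 1) / 2 * P.numInner + (Fintype.card W + 1).choose 2))

/-- The upper bound for the second moment of the number of copies up to a term of lower order. -/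
noncomputable def sqUpperBound (n : ℕ) : ℝ :=
  ((((n + 1) / 2 : ℕ) : ℝ) ^ Fintype.card W * P.edgesProb (bisectionProb n dPos dNeg)) ^ 2 *
    noEdgeProb (bisectionProb n dPos dNeg) ^
      ((n / 2 - 2 * Fintype.card W) * (2 * P.numInner))

lemma tendsto_meanLowerBound_div :
    Tendsto (fun n : ℕ => P.meanLowerBound dPos dNeg n / n) atTop
      (𝓝 (P.copyDensity dPos dNeg)) := by
  have h1 := P.tendsto_pow_mul_edgesProb dPos dNeg (tendsto_div_half
    (f := fun n => n / 2 - Fintype.card W) (2 * Fintype.card W + 1) (by intro n; omega)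
    (by intro n; omega))
  have h2 : Tendsto (fun n : ℕ => (((n + 1) / 2 * P.numInner +
      (Fintype.card W + 1).choose 2 : ℕ) : ℝ) / n) atTop (𝓝 ((P.numInner : ℝ) * (1 / 2))) := by
    have h3 := ((tendsto_div_half (f := fun n => (n + 1) / 2) 1 (by intro n; omega)
      (by intro n; omega)).const_mul (P.numInner : ℝ)).add
      (tendsto_const_div_atTop_nhds_zero_nat (((Fintype.card W + 1).choose 2 : ℕ) : ℝ))
    rw [add_zero] at h3
    refine h3.congr fun n => ?_
    push_cast
    ring
  rw [copyDensity_eq]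
  refine (h1.mul (tendsto_noEdgeProb_pow dPos dNeg h2)).congr fun n => ?_
  rw [meanLowerBound]
  ring

lemma tendsto_sqUpperBound_div :
    Tendsto (fun n : ℕ => P.sqUpperBound dPos dNeg n / n ^ 2) atTop
      (𝓝 (P.copyDensity dPos dNeg ^ 2)) := by
  have h1 := P.tendsto_pow_mul_edgesProb dPos dNeg (tendsto_div_half
    (f := fun n => (n + 1) / 2) 1 (by intro n; omega) (by intro n; omega))
  have h2 : Tendsto (fun n : ℕ => (((n / 2 - 2 * Fintype.card W) * (2 * P.numInner) : ℕ) : ℝ) / n)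
      atTop (𝓝 ((P.numInner : ℝ) * (1 / 2) * 2)) := by
    have h3 := ((tendsto_div_half (f := fun n => n / 2 - 2 * Fintype.card W)
      (4 * Fintype.card W + 1) (by intro n; omega)
      (by intro n; omega)).const_mul (2 * (P.numInner : ℝ)))
    convert h3 using 2
    · push_cast
      ring
    · ring
  rw [copyDensity_eq, mul_pow, ← Real.rpow_natCast (_ ^ _) 2, ← Real.rpow_mul (by positivity),
    Nat.cast_ofNat]
  refine ((h1.pow 2).mul (tendsto_noEdgeProb_pow dPos dNeg h2)).congr fun n => ?_
  rw [sqUpperBound]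
  ring

end RootedLabelledGraph.ParentMap

instance {V : Type*} [Finite V] : DiscreteMeasurableSpace (SimpleGraph V) :=
  ⟨fun s => ⟨SimpleGraph.Adj '' s, DiscreteMeasurableSpace.forall_measurableSet _,
    Set.preimage_image_eq s fun _ _ h => SimpleGraph.ext h⟩⟩

/-! ### Averaging over the planted map; vertices near cycles -/

namespace PlantedBisection

lemma balanced_nonempty (n : ℕ) : (balanced n).Nonempty := by
  refine ⟨fun i => if (i : ℕ) < n / 2 then 1 else -1, ?_⟩
  have h1 : (Finset.univ.filter fun i : Fin n => (if (i : ℕ) < n / 2 then (1 : ℤˣ) else -1) = 1) =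
      Finset.univ.filter fun i : Fin n => (i : ℕ) < n / 2 := by
    refine Finset.filter_congr fun i _ => ?_
    split_ifs with h <;> simp [h]
  have h2 : (Finset.univ.filter fun i : Fin n => (if (i : ℕ) < n / 2 then (1 : ℤˣ) else -1) = -1) =
      Finset.univ.filter fun i : Fin n => ¬ (i : ℕ) < n / 2 := by
    refine Finset.filter_congr fun i _ => ?_
    split_ifs with h
    · simp [h]
    · simp [h]
  have h3 := Finset.card_filter_add_card_filter_not (s := (Finset.univ : Finset (Fin n)))
    (fun i => (i : ℕ) < n / 2)
  have h4 : (Finset.univ.filter fun i : Fin n => (i : ℕ) < n / 2).card = n / 2 := by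
    rw [Fin.card_filter_val_lt]
    omega
  rw [Finset.card_univ, Fintype.card_fin] at h3
  rw [balanced, Finset.mem_filter, h1, h2]
  refine ⟨Finset.mem_univ _, ?_⟩
  rw [abs_le]
  omega

lemma card_class_of_mem_balanced {n : ℕ} {σ : Fin n → ℤˣ} (hσ : σ ∈ balanced n) (s : ℤˣ) :
    n / 2 ≤ (Finset.univ.filter fun z => σ z = s).card ∧
      (Finset.univ.filter fun z => σ z = s).card ≤ (n + 1) / 2 := by
  have h1 := (Finset.mem_filter.1 hσ).2
  have h2 := Finset.card_filter_add_card_filter_not (s := (Finset.univ : Finset (Fin n)))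
    (fun i => σ i = 1)
  have h3 : (Finset.univ.filter fun i : Fin n => ¬ σ i = 1) =
      Finset.univ.filter fun i : Fin n => σ i = -1 := by
    refine Finset.filter_congr fun i _ => ?_
    rcases Int.units_eq_one_or (σ i) with h | h <;> simp [h]
  rw [h3, Finset.card_univ, Fintype.card_fin] at h2
  rw [abs_le] at h1
  rcases Int.units_eq_one_or s with rfl | rfl <;> omega

variable (n : ℕ) (dPos dNeg : ℝ≥0)

lemma law_eq : law n dPos dNeg = ((balanced n).card : ℝ≥0∞)⁻¹ • ∑ σ ∈ balanced n,
    (edgeMeasure (pairProb σ (bisectionProb n dPos dNeg))).map fun b => (σ, graphOf b) := by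
  rw [law]
  congr 1
  refine Finset.sum_congr rfl fun σ _ => ?_
  rw [graphLaw, Measure.map_map Measurable.of_discrete Measurable.of_discrete]
  rfl

lemma law_apply (S : Set ((Fin n → ℤˣ) × SimpleGraph (Fin n))) :
    law n dPos dNeg S = ((balanced n).card : ℝ≥0∞)⁻¹ * ∑ σ ∈ balanced n,
      edgeMeasure (pairProb σ (bisectionProb n dPos dNeg)) {b | (σ, graphOf b) ∈ S} := by
  rw [law_eq, Measure.smul_apply, smul_eq_mul, Measure.finsetSum_apply]
  congr 1
  refine Finset.sum_congr rfl fun σ _ => ?_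
  rw [Measure.map_apply Measurable.of_discrete (DiscreteMeasurableSpace.forall_measurableSet _)]
  rfl

instance : IsProbabilityMeasure (law n dPos dNeg) := by
  refine ⟨?_⟩
  have h1 : ((balanced n).card : ℝ≥0∞) ≠ 0 := by
    exact_mod_cast (Finset.card_pos.2 (balanced_nonempty n)).ne'
  rw [law_apply]
  simp only [Set.mem_univ, Set.ofPred_true, measure_univ, Finset.sum_const, nsmul_eq_mul, mul_one]
  exact ENNReal.inv_mul_cancel h1 (ENNReal.natCast_ne_top _)

variable {n dPos dNeg}

/-- A bound for every planted map gives a bound for the planted bisection model. -/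
lemma law_real_le {S : Set ((Fin n → ℤˣ) × SimpleGraph (Fin n))} {δ : ℝ}
    (h : ∀ σ ∈ balanced n, (edgeMeasure (pairProb σ (bisectionProb n dPos dNeg))).real
      {b | (σ, graphOf b) ∈ S} ≤ δ) : (law n dPos dNeg).real S ≤ δ := by
  obtain ⟨σ₀, hσ₀⟩ := balanced_nonempty n
  have hδ : 0 ≤ δ := measureReal_nonneg.trans (h σ₀ hσ₀)
  have h1 : ((balanced n).card : ℝ≥0∞) ≠ 0 := by
    exact_mod_cast (Finset.card_pos.2 ⟨σ₀, hσ₀⟩).ne'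
  rw [measureReal_def]
  refine ENNReal.toReal_le_of_le_ofReal hδ ?_
  rw [law_apply]
  calc _ ≤ ((balanced n).card : ℝ≥0∞)⁻¹ * ∑ σ ∈ balanced n, ENNReal.ofReal δ := by
        gcongr with σ hσ
        rw [← ofReal_measureReal]
        exact ENNReal.ofReal_le_ofReal (h σ hσ)
    _ = ENNReal.ofReal δ := by
        rw [Finset.sum_const, nsmul_eq_mul, ← mul_assoc,
          ENNReal.inv_mul_cancel h1 (ENNReal.natCast_ne_top _), one_mul]

lemma bisectionProb_le (hd : dNeg ≤ dPos) (s : ℤˣ) :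
    (bisectionProb n dPos dNeg s : ℝ) ≤ (2 * dPos + 1 : ℝ) / n := by
  rw [bisectionProb]
  split_ifs
  · exact edgeProb_le n le_rfl
  · exact edgeProb_le n hd

/-- Every vertex counted lies in a dense set of excess one, and each such set has at most `2 * t +
2` elements. -/
lemma ncard_not_isAcyclic_le (G : SimpleGraph (Fin n)) (σ : Fin n → ℤˣ) (t : ℕ) :
    {v | ¬ ((rootedAt (σ, G) v).nbhd t).graph.IsAcyclic}.ncard ≤
      (2 * t + 2) * (denseSets G (2 * t + 2) 1).card := by
  classical
  have hsub : {v | ¬ ((rootedAt (σ, G) v).nbhd t).graph.IsAcyclic} ⊆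
      (((denseSets G (2 * t + 2) 1).biUnion id : Finset (Fin n)) : Set (Fin n)) := by
    intro v hv
    obtain ⟨S, hr, hc, hS⟩ := RootedLabelledGraph.exists_spansEdges_of_not_isAcyclic
      (rootedAt (σ, G) v) t hv
    have hS' : S ∈ denseSets G (2 * t + 2) 1 := by
      refine mem_denseSets.2 ⟨⟨_, hr⟩, hc, ?_⟩
      rwa [Nat.sub_add_cancel (Finset.card_pos.2 ⟨_, hr⟩)]
    exact Finset.mem_coe.2 (Finset.mem_biUnion.2 ⟨S, hS', hr⟩)
  refine (Set.ncard_le_ncard hsub (Finset.finite_toSet _)).trans ?_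
  rw [Set.ncard_coe_finset, mul_comm (2 * t + 2)]
  exact Finset.card_biUnion_le_card_mul _ _ _ fun S (hS : S ∈ denseSets G _ 1) =>
    (mem_denseSets.1 hS).2.1

/-- Few vertices have a cycle in their neighbourhood. -/
lemma tendsto_law_real_not_isAcyclic (hd : dNeg ≤ dPos) (t : ℕ) :
    Tendsto (fun n : ℕ => (law n dPos dNeg).real
      {ω | ({v | ¬ ((rootedAt ω v).nbhd t).graph.IsAcyclic}.ncard : ℝ) ≤ Real.log n})
      atTop (𝓝 1) := by
  set D : ℝ := 2 * dPos + 1 with hD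
  have hD1 : 1 ≤ D := by
    have := dPos.2
    change 0 ≤ (dPos : ℝ) at this
    linarith
  set K := 2 * t + 2 with hK
  -- The outer `K` bounds the vertices per dense set, the bracket the mean number of dense sets.
  -- Markov's inequality then bounds the failure probability by `C / log n`.
  set C : ℝ := K * (K * 2 ^ (K + 1).choose 2 * D ^ (K + 1)) with hC
  have hlim : Tendsto (fun n : ℕ => 1 - C / Real.log n) atTop (𝓝 1) := by
    have h1 : Tendsto (fun n : ℕ => C / Real.log n) atTop (𝓝 0) :=
      (Real.tendsto_log_atTop.comp tendsto_natCast_atTop_atTop).const_div_atTop C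
    simpa only [sub_zero] using h1.const_sub 1
  refine tendsto_of_tendsto_of_tendsto_of_le_of_le' hlim tendsto_const_nhds ?_
    (Eventually.of_forall fun n => measureReal_le_one)
  filter_upwards [eventually_ge_atTop 2] with n hn
  have hn0 : (0 : ℝ) < n := by positivity
  have hlog : 0 < Real.log n := Real.log_pos (by exact_mod_cast hn)
  rw [sub_le_iff_le_add', ← sub_le_iff_le_add,
    ← probReal_compl_eq_one_sub (DiscreteMeasurableSpace.forall_measurableSet _)]
  refine law_real_le fun σ _ => ?_
  have hmean := integral_card_denseSets_le (V := Fin n) (pairProb σ (bisectionProb n dPos dNeg))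
    hD1 (fun e => by rw [Fintype.card_fin]; exact bisectionProb_le hd _) K 1
  rw [Fintype.card_fin, pow_one, mul_comm (n : ℝ), mul_le_mul_iff_left₀ hn0] at hmean
  set μ := edgeMeasure (pairProb σ (bisectionProb n dPos dNeg)) with hμ
  rw [le_div_iff₀ hlog, mul_comm]
  calc _ ≤ Real.log n * μ.real
        {b | Real.log n ≤ K * ((denseSets (graphOf b) K 1).card : ℝ)} := by
        refine mul_le_mul_of_nonneg_left (measureReal_mono ?_ (measure_ne_top _ _)) hlog.le
        intro b hb
        have h1 : Real.log n < _ := not_le.1 hb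
        refine h1.le.trans ?_
        exact_mod_cast ncard_not_isAcyclic_le (graphOf b) σ t
    _ ≤ ∫ b, K * ((denseSets (graphOf b) K 1).card : ℝ) ∂μ :=
        mul_meas_ge_le_integral_of_nonneg (Eventually.of_forall fun b => by positivity)
          Integrable.of_finite _
    _ ≤ C := by
        rw [integral_const_mul]
        exact mul_le_mul_of_nonneg_left hmean (by positivity)

end PlantedBisection

/-! ### Concentration and the theorem -/

namespace RootedLabelledGraph.ParentMap

open PlantedBisection

variable {W : Type*} [Fintype W] [DecidableEq W]
  {X : RootedLabelledGraph W} {t : ℕ} {dPos dNeg : ℝ≥0}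

/-- The proportion of vertices whose neighbourhood is isomorphic to `X` concentrates. -/
lemma tendsto_law_real_isom (P : X.ParentMap t) (hd : dNeg ≤ dPos) {ε : ℝ} (hε : 0 < ε) :
    Tendsto (fun n : ℕ => (PlantedBisection.law n dPos dNeg).real
      {ω | ε < |({v | ((rootedAt ω v).nbhd t).Isom X}.ncard : ℝ) / n -
        (GaltonWatson.law dPos dNeg).real {ω' | ((GaltonWatson.tree ω').nbhd t).Isom X}|})
      atTop (𝓝 0) := by
  set D : ℝ := 2 * dPos + 1 with hD
  have hD1 : 1 ≤ D := by
    have := dPos.2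
    change 0 ≤ (dPos : ℝ) at this
    linarith
  set m := Fintype.card W with hm
  set a : ℝ := ((Nat.card (Isos X X) : ℕ) : ℝ) with ha
  have ha0 : 0 < a := by
    rw [ha]
    exact_mod_cast Nat.card_pos (α := Isos X X)
  set q := (GaltonWatson.law dPos dNeg).real {ω' | ((GaltonWatson.tree ω').nbhd t).Isom X} with hq
  set c := P.copyDensity dPos dNeg with hc
  have hcq : a * q = c := P.card_isos_mul_law_real dPos dNeg
  have hc0 : 0 ≤ c := by
    rw [← hcq]
    exact mul_nonneg ha0.le measureReal_nonneg
  set C : ℝ := (((2 * m : ℕ) : ℝ) ^ m) ^ 2 *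
    (((2 * m : ℕ) : ℝ) * 2 ^ (2 * m + 1).choose 2 * D ^ (2 * m)) with hC
  -- In the limit the numerator is `c² + 0 - 2c² + c² = 0`; `C / n` is the share of the pairs of
  -- meeting copies.
  have hlim : Tendsto (fun n : ℕ => (P.sqUpperBound dPos dNeg n / n ^ 2 + C / n -
      2 * c * (P.meanLowerBound dPos dNeg n / n) + c ^ 2) / (a * ε) ^ 2) atTop (𝓝 0) := by
    have h1 := ((((P.tendsto_sqUpperBound_div dPos dNeg).add
      (tendsto_const_div_atTop_nhds_zero_nat C)).sub
      ((P.tendsto_meanLowerBound_div dPos dNeg).const_mul (2 * c))).add_const (c ^ 2)).div_const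
      ((a * ε) ^ 2)
    convert h1 using 2
    rw [← hc]
    ring
  refine tendsto_of_tendsto_of_tendsto_of_le_of_le' tendsto_const_nhds hlim
    (Eventually.of_forall fun n => measureReal_nonneg) ?_
  filter_upwards [eventually_ge_atTop 1] with n hn
  have hn0 : (0 : ℝ) < n := by positivity
  refine law_real_le fun σ hσ => ?_
  have hlo := fun s => (card_class_of_mem_balanced hσ s).1
  have hhi := fun s => (card_class_of_mem_balanced hσ s).2
  have hmean := P.le_integral_card_copies (bisectionProb n dPos dNeg) hlo hhi
  have hsq := P.integral_card_copies_sq_le (bisectionProb n dPos dNeg) hlo hhi hD1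
    (fun s => by rw [Fintype.card_fin]; exact bisectionProb_le hd s)
  set μ := edgeMeasure (pairProb σ (bisectionProb n dPos dNeg)) with hμ
  set N : (Sym2 (Fin n) → Prop) → ℝ := fun b => ((P.copies (graphOf b) σ).card : ℝ) with hN
  have hcard : ∀ b, N b = a * ({v | ((rootedAt (σ, graphOf b) v).nbhd t).Isom X}.ncard : ℝ) := by
    intro b
    have := P.card_copies_eq (graphOf b) σ
    simp only [hN, ha]
    exact_mod_cast this
  rw [le_div_iff₀ (by positivity), mul_comm]
  -- The deviation is measured from the limit `c`, not from the mean, so no upper bound on the mean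
  -- is needed.
  calc _ ≤ (a * ε) ^ 2 * μ.real {b | (a * ε) ^ 2 ≤ (N b / n - c) ^ 2} := by
        refine mul_le_mul_of_nonneg_left (measureReal_mono ?_ (measure_ne_top _ _)) (by positivity)
        intro b hb
        have h1 : ε < |({v | ((rootedAt (σ, graphOf b) v).nbhd t).Isom X}.ncard : ℝ) / n - q| := hb
        have h2 : N b / n - c =
            a * (({v | ((rootedAt (σ, graphOf b) v).nbhd t).Isom X}.ncard : ℝ) / n - q) := by
          rw [hcard, ← hcq]
          ring
        change (a * ε) ^ 2 ≤ (N b / n - c) ^ 2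
        rw [h2, mul_pow, mul_pow, ← sq_abs (_ - q)]
        gcongr
    _ ≤ ∫ b, (N b / n - c) ^ 2 ∂μ :=
        mul_meas_ge_le_integral_of_nonneg (Eventually.of_forall fun b => sq_nonneg _)
          Integrable.of_finite _
    _ = (∫ b, N b ^ 2 ∂μ) / n ^ 2 - 2 * c * ((∫ b, N b ∂μ) / n) + c ^ 2 := by
        have h1 : ∀ b, (N b / n - c) ^ 2 = N b ^ 2 / n ^ 2 - 2 * c * (N b / n) + c ^ 2 := by
          intro b
          ring
        simp_rw [h1]
        rw [integral_add Integrable.of_finite Integrable.of_finite,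
          integral_sub Integrable.of_finite Integrable.of_finite, integral_div,
          integral_const_mul, integral_div]
        simp
    _ ≤ _ := by
        have h1 : (∫ b, N b ^ 2 ∂μ) / n ^ 2 ≤ P.sqUpperBound dPos dNeg n / n ^ 2 + C / n := by
          have h2 : C / n = C * n / n ^ 2 := by field_simp
          rw [h2, ← add_div]
          refine div_le_div_of_nonneg_right (hsq.trans_eq ?_) (by positivity)
          rw [sqUpperBound, hC, Fintype.card_fin]
          ring
        have h3 : P.meanLowerBound dPos dNeg n / n ≤ (∫ b, N b ∂μ) / n :=
          div_le_div_of_nonneg_right hmean hn0.le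
        -- The mean enters with the coefficient `-2c ≤ 0`, hence its lower bound is the useful one.
        have h4 := mul_le_mul_of_nonneg_left h3 (mul_nonneg zero_le_two hc0)
        linarith

end RootedLabelledGraph.ParentMap

lemma RootedLabelledGraph.Isom.finite {V W : Type*} {X : RootedLabelledGraph V}
    {Y : RootedLabelledGraph W} (h : X.Isom Y) [Finite V] : Finite W := by
  obtain ⟨φ, -⟩ := h
  exact Finite.of_equiv V φ.toEquiv

theorem lemma2p3 {V : Type*} (dPos dNeg : ℝ≥0) (hd : dNeg < dPos) (t : ℕ)
    (T : RootedLabelledGraph V) (hT : T.graph.IsTree) :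
    (∀ ε : ℝ, 0 < ε →
      Tendsto
        (fun n : ℕ => (PlantedBisection.law n dPos dNeg).real
          {ω | ε < |({v | ((PlantedBisection.rootedAt ω v).nbhd t).Isom (T.nbhd t)}.ncard : ℝ) / n
            - (GaltonWatson.law dPos dNeg).real
                {ω' | ((GaltonWatson.tree ω').nbhd t).Isom (T.nbhd t)}|})
        atTop (𝓝 0)) ∧
    Tendsto
      (fun n : ℕ => (PlantedBisection.law n dPos dNeg).real
        {ω | ({v | ¬ ((PlantedBisection.rootedAt ω v).nbhd t).graph.IsAcyclic}.ncard : ℝ)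
          ≤ Real.log n})
      atTop (𝓝 1) := by
  refine ⟨fun ε hε => ?_, PlantedBisection.tendsto_law_real_not_isAcyclic hd.le t⟩
  -- `T` need not be locally finite. An infinite ball is isomorphic to no ball of `G` or of the
  -- Galton–Watson tree, so both quantities vanish.
  by_cases hfin : Finite {v : V // T.graph.edist T.root v ≤ (t : ℕ∞)}
  · classical
    have : Fintype {v : V // T.graph.edist T.root v ≤ (t : ℕ∞)} := Fintype.ofFinite _
    exact (T.nbhdParentMap t hT).tendsto_law_real_isom hd.le hε
  · have h1 : ∀ ω', ¬ ((GaltonWatson.tree ω').nbhd t).Isom (T.nbhd t) := fun ω' h =>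
      have := GaltonWatson.finite_nbhd ω' t
      hfin h.finite
    have h2 : ∀ (n : ℕ) (ω : (Fin n → ℤˣ) × SimpleGraph (Fin n)) (v : Fin n),
        ¬ ((PlantedBisection.rootedAt ω v).nbhd t).Isom (T.nbhd t) := fun n ω v h => hfin h.finite
    simp [h1, h2, not_lt.2 hε.le]
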